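/- \textbf{Setting.} Consider a base station with $N$ antennas, a RIS with $M$ elements, $K$ users and $J$ eavesdroppers; fix a user $k$, an eavesdropper $j$ and a phase matrix $\Theta=\mathrm{diag}(e)$ with $|e_m|=1$. Channels are $H\in\mathbb C^{M\times N}$, $h_{r,k}\in\mathbb C^M$, $h_{d,k}\in\mathbb C^N$; path losses $\alpha_1,\alpha_{r,k},\alpha_{d,k},\alpha_{r,j},\alpha_{d,j}>0$, noise variances $\sigma_k^2,\sigma_j^2>0$, fading variances $\mu_{r,j}^2,\mu_{d,j}^2>0$, outage level $\varepsilon_k\in(0,1)$. Put $\hat h=\sqrt{\alpha_1\alpha_{r,k}}\,h_{r,k}^H\Theta H+\sqrt{\alpha_{d,k}}\,h_{d,k}^H$, $\kappa_1=\alpha_1\alpha_{r,j}\mu_{r,j}^2/\sigma_j^2$, $\kappa_2=\alpha_{d,j}\mu_{d,j}^2/\sigma_j^2$, $q(w)=(\kappa_1\|\Theta Hw\|^2+\kappa_2\|w\|^2)\ln\varepsilon_k^{-1}$, $f(w)=\log_2\frac{1+|\hat hw|^2/\sigma_k^2}{1+q(w)}$ and $Y(w)=\frac1\eta\|w\|^2+P_a+KP_c+MP_s$,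 where $1/\eta\ge 0$, $P_a,P_c,P_s\ge 0$ and $P_a+KP_c+MP_s>0$. The beamforming problem is $$\mathcal D1:\quad \max_{w\in\mathbb C^N}\ \frac{[f(w)]^+}{Y(w)}\quad\text{s.t. }\|w\|^2\le P_{\max}.$$ \textbf{Algorithm.} For $v\in\mathbb C^N$ let $X_v=R_{1,v}-R_{2,v}$ with $$R_{1,v}(w)=\log_2\Big(1+\frac{|\hat hv|^2}{\sigma_k^2}\Big)+\frac{2\Re\{\overline{\hat hv}\,\hat hw\}}{\sigma_k^2\ln2}-\frac{(\sigma_k^2+|\hat hw|^2)|\hat hv|^2}{(\sigma_k^2+|\hat hv|^2)\sigma_k^2\ln2}-\frac{|\hat hv|^2}{\sigma_k^2\ln2},$$ $$R_{2,v}(w)=\log_2(1+q(v))+\frac{q(w)-q(v)}{(1+q(v))\ln2}.$$ Start from $w^{(0)}$. For $t=0,1,\dots$: choose $\gamma^{(t,0)}>0$; for $l=0,1,\dots$ set $\Phi(w)=2\gamma^{(t,l)}\sqrt{X_{w^{(t)}}(w)}-(\gamma^{(t,l)})^2Y(w)$ and run accelerated projected gradient (FISTA): $x^{(0)}=w^{(t)}$,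 $f^{(0)}=x^{(0)}$, $f^{(i)}=x^{(i)}+\frac{a^{(i-1)}-1}{a^{(i)}}(x^{(i)}-x^{(i-1)})$ for $i\ge1$, where $a^{(0)}=1$, $a^{(i)}=\frac{1+\sqrt{1+4(a^{(i-1)})^2}}2$, and $x^{(i+1)}$ is the projection of $f^{(i)}+s_i\nabla\Phi(f^{(i)})$ onto $\{\|x\|^2\le P_{\max}\}$ (real gradient). The step sizes $s_i$ are nonincreasing, bounded below by a positive constant, and satisfy the sufficient-increase (Armijo) condition $\Phi(x^{(i+1)})\ge\Phi(f^{(i)})+\Re\langle\nabla\Phi(f^{(i)}),x^{(i+1)}-f^{(i)}\rangle-\frac1{2s_i}\|x^{(i+1)}-f^{(i)}\|^2$. Output the limit $x^{\diamond}_{t,l}=\lim_i x^{(i)}$, and set $\gamma^{(t,l+1)}=\sqrt{X_{w^{(t)}}(x^\diamond_{t,l})}/Y(x^\diamond_{t,l})$. Finally $w^{(t+1)}=\lim_l x^\diamond_{t,l}$. The run is assumed well defined: always $X_{w^{(t)}}(f^{(i)})>0$ (so the gradient exists; in particular $f(w^{(0)})>0$) and $X_{w^{(t)}}(x^{(i+1)})\ge0$.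 \textbf{Theorem.} If $\|w^{(0)}\|^2\le P_{\max}$, then for every such run the inner limits $x^\diamond_{t,l}=\lim_i x^{(i)}$ exist for all $t,l$, the limits $w^{(t+1)}=\lim_l x^\diamond_{t,l}$ exist for all $t$, and the sequence $w^{(t)}$ converges to a point that is a KKT point of $\mathcal D1$ and a local maximizer of $\mathcal D1$. -/

import Mathlib

open Filter Topology

noncomputable section

namespace SecureRIS

/-- Complex column vectors of length `n` with the Euclidean norm. Mathlib also regards them as a
real inner product space, with inner product `Re (xᴴ y)`; gradients below are real gradients. -/
abbrev CVec (n : ℕ) : Type := EuclideanSpace ℂ (Fin n)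

/-- Data of a downlink multicast network: an `N`-antenna base station (BS), a reconfigurable
intelligent surface (RIS) with `M` elements, `K` users and `J` eavesdroppers (Eves). -/
structure Network (K J N M : ℕ) where
  /-- BS-RIS channel -/
  H : Matrix (Fin M) (Fin N) ℂ
  /-- RIS-user channels -/
  hr : Fin K → Fin M → ℂ
  /-- BS-user channels -/
  hd : Fin K → Fin N → ℂ
  /-- path loss of the links BS-RIS, RIS-user, BS-user, RIS-Eve, BS-Eve -/
  α₁ : ℝ
  αrU : Fin K → ℝ
  αdU : Fin K → ℝ
  αrE : Fin J → ℝ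
  αdE : Fin J → ℝ
  /-- standard deviations of the Rayleigh-fading channels RIS-Eve and BS-Eve -/
  μr : Fin J → ℝ
  μd : Fin J → ℝ
  /-- standard deviations of the noise at the users and at the Eves -/
  σU : Fin K → ℝ
  σE : Fin J → ℝ
  /-- maximum tolerable secrecy outage probabilities -/
  ε : Fin K → ℝ
  /-- the coefficient `1/η` of the transmit power, `η` being the amplifier efficiency; the value
  `0` is allowed and turns energy efficiency into spectral efficiency -/
  etaInv : ℝ
  /-- hardware power at the BS, circuit power per user, hardware power per RIS element -/
  Pa : ℝ
  Pc : ℝ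
  Ps : ℝ
  /-- transmit power budget -/
  Pmax : ℝ
  α₁_pos : 0 < α₁
  αrU_pos : ∀ k, 0 < αrU k
  αdU_pos : ∀ k, 0 < αdU k
  αrE_pos : ∀ j, 0 < αrE j
  αdE_pos : ∀ j, 0 < αdE j
  μr_pos : ∀ j, 0 < μr j
  μd_pos : ∀ j, 0 < μd j
  σU_pos : ∀ k, 0 < σU k
  σE_pos : ∀ j, 0 < σE j
  ε_pos : ∀ k, 0 < ε k
  ε_lt_one : ∀ k, ε k < 1
  etaInv_nonneg : 0 ≤ etaInv
  Pa_nonneg : 0 ≤ Pa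
  Pc_nonneg : 0 ≤ Pc
  Ps_nonneg : 0 ≤ Ps
  static_pos : 0 < Pa + K * Pc + M * Ps

namespace Network

variable {K J N M : ℕ} (S : Network K J N M)

/-- `κ₁ⱼ = α₁ α_{r,j} μ_{r,j}² / σⱼ²` -/
def κ₁ (j : Fin J) : ℝ := S.α₁ * S.αrE j * S.μr j ^ 2 / S.σE j ^ 2

/-- `κ₂ⱼ = α_{d,j} μ_{d,j}² / σⱼ²` -/
def κ₂ (j : Fin J) : ℝ := S.αdE j * S.μd j ^ 2 / S.σE j ^ 2

/-- `ΘH` with `Θ = diag e` -/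
def ThetaH (e : Fin M → ℂ) : Matrix (Fin M) (Fin N) ℂ := Matrix.diagonal e * S.H

/-- `ĥ = √(α₁ α_{r,k}) h_{r,k}ᴴ Θ H + √α_{d,k} h_{d,k}ᴴ`, a row vector -/
def hhat (k : Fin K) (e : Fin M → ℂ) : Fin N → ℂ :=
  (Real.sqrt (S.α₁ * S.αrU k) : ℂ) • Matrix.vecMul (star (S.hr k)) (S.ThetaH e)
    + (Real.sqrt (S.αdU k) : ℂ) • star (S.hd k)

/-- the complex number `ĥ w` -/
def hw (k : Fin K) (e : Fin M → ℂ) (w : CVec N) : ℂ := ∑ n, S.hhat k e n * w n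

/-- `(κ₁ⱼ ‖ΘHw‖² + κ₂ⱼ ‖w‖²) ln (1/ε_k)` -/
def leak (k : Fin K) (j : Fin J) (e : Fin M → ℂ) (w : CVec N) : ℝ :=
  (S.κ₁ j * ‖(WithLp.toLp 2 (Matrix.mulVec (S.ThetaH e) (fun n => w n)) : CVec M)‖ ^ 2
    + S.κ₂ j * ‖w‖ ^ 2) * Real.log (S.ε k)⁻¹

/-- the secrecy rate `f(w)` (before the positive part) -/
def f (k : Fin K) (j : Fin J) (e : Fin M → ℂ) (w : CVec N) : ℝ :=
  Real.logb 2 ((1 + ‖S.hw k e w‖ ^ 2 / S.σU k ^ 2) / (1 + S.leak k j e w))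

/-- total power consumption `(1/η) Tr(w wᴴ) + P_a + K P_c + M P_s`; note `Tr(w wᴴ) = ‖w‖²` -/
def totalPower (w : CVec N) : ℝ :=
  S.etaInv * ‖w‖ ^ 2 + S.Pa + K * S.Pc + M * S.Ps

/-- the objective of the beamforming problem -/
def objective (k : Fin K) (j : Fin J) (e : Fin M → ℂ) (w : CVec N) : ℝ :=
  max (S.f k j e w) 0 / S.totalPower w

/-- the feasible set of the beamforming problem -/
def feasible : Set (CVec N) := {w | ‖w‖ ^ 2 ≤ S.Pmax}

/-- Karush-Kuhn-Tucker point of: maximize `objective` subject to `‖w‖² ≤ Pmax`. The last conjunct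
is stationarity of the Lagrangian with multiplier `lam`. -/
def IsKKTPoint (k : Fin K) (j : Fin J) (e : Fin M → ℂ) (w : CVec N) : Prop :=
  w ∈ S.feasible ∧ ∃ lam : ℝ, 0 ≤ lam ∧ lam * (‖w‖ ^ 2 - S.Pmax) = 0 ∧
    HasGradientAt (fun v : CVec N => S.objective k j e v - lam * (‖v‖ ^ 2 - S.Pmax)) 0 w

/-- concave minorant of the user's rate at the point `wt` -/
def R₁ (k : Fin K) (e : Fin M → ℂ) (wt w : CVec N) : ℝ :=
  Real.logb 2 (1 + ‖S.hw k e wt‖ ^ 2 / S.σU k ^ 2)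
    + 2 * (star (S.hw k e wt) * S.hw k e w).re / (S.σU k ^ 2 * Real.log 2)
    - (S.σU k ^ 2 + ‖S.hw k e w‖ ^ 2) * ‖S.hw k e wt‖ ^ 2
        / ((S.σU k ^ 2 + ‖S.hw k e wt‖ ^ 2) * S.σU k ^ 2 * Real.log 2)
    - ‖S.hw k e wt‖ ^ 2 / (S.σU k ^ 2 * Real.log 2)

/-- convex majorant of the redundancy rate at the point `wt` -/
def R₂ (k : Fin K) (j : Fin J) (e : Fin M → ℂ) (wt w : CVec N) : ℝ :=
  Real.logb 2 (1 + S.leak k j e wt)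
    + (S.leak k j e w - S.leak k j e wt) / ((1 + S.leak k j e wt) * Real.log 2)

/-- the path-following surrogate `R₁ - R₂` of `f` at the point `wt` -/
def surrogate (k : Fin K) (j : Fin J) (e : Fin M → ℂ) (wt w : CVec N) : ℝ :=
  S.R₁ k e wt w - S.R₂ k j e wt w

/-- the quadratic-transform objective `Φ`; meaningful where the surrogate is nonnegative -/
def Phi (k : Fin K) (j : Fin J) (e : Fin M → ℂ) (wt : CVec N) (g : ℝ) (w : CVec N) : ℝ :=
  2 * g * Real.sqrt (S.surrogate k j e wt w) - g ^ 2 * S.totalPower w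

end Network

/-- momentum parameters: `a₀ = 1`, `aᵢ₊₁ = (1 + √(1 + 4 aᵢ²)) / 2` -/
def momentum : ℕ → ℝ
  | 0 => 1
  | i + 1 => (1 + Real.sqrt (1 + 4 * momentum i ^ 2)) / 2

/-- extrapolated point `xᵢ + ((aᵢ₋₁ - 1) / aᵢ) (xᵢ - xᵢ₋₁)`; there is no momentum at `i = 0` -/
def extrapolate {n : ℕ} (x : ℕ → CVec n) : ℕ → CVec n
  | 0 => x 0
  | i + 1 => x (i + 1) + ((momentum i - 1) / momentum (i + 1)) • (x (i + 1) - x i)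

/-- Euclidean projection onto the ball `‖x‖² ≤ P` -/
def projBall {n : ℕ} (P : ℝ) (v : CVec n) : CVec n :=
  if ‖v‖ ^ 2 ≤ P then v else (Real.sqrt P / ‖v‖) • v

/-- `x` is a run, with step sizes `s` and initial point `x₀`, of the accelerated projected-gradient
method (FISTA with variable step size) for maximizing `2g√X - g²Y`-type functions `Φ` over the ball
`‖x‖² ≤ P`, where `Φ` has the domain `X ≥ 0` and is differentiable where `X > 0`.
* `dom`: every gradient is taken at a point where `Φ` is differentiable.
* `armijo`, `armijo_dom`: the new point lies in the domain of `Φ`, and the increase of `Φ` is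
  sufficient (for a step that needs no projection: `Φ(xᵢ₊₁) ≥ Φ(fᵢ) + (sᵢ/2) ‖∇Φ(fᵢ)‖²`).
* the step sizes do not increase and do not degenerate to `0`. -/
structure IsAPGRun {n : ℕ} (Φ X : CVec n → ℝ) (P : ℝ) (x₀ : CVec n)
    (x : ℕ → CVec n) (s : ℕ → ℝ) : Prop where
  init : x 0 = x₀
  update : ∀ i, x (i + 1) =
    projBall P (extrapolate x i + s i • gradient Φ (extrapolate x i))
  dom : ∀ i, 0 < X (extrapolate x i)
  step_antitone : Antitone s
  step_lower : ∃ c : ℝ, 0 < c ∧ ∀ i, c ≤ s i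
  armijo_dom : ∀ i, 0 ≤ X (x (i + 1))
  armijo : ∀ i,
    Φ (extrapolate x i)
      + inner ℝ (gradient Φ (extrapolate x i)) (x (i + 1) - extrapolate x i)
      - ‖x (i + 1) - extrapolate x i‖ ^ 2 / (2 * s i) ≤ Φ (x (i + 1))

/-- A run of the three nested loops (`t`: path following, `l`: quadratic transform, `i`: accelerated
projected gradient) from the beamformer `w₀`. Each inner loop is run to convergence: its output is
the limit of its iterates. `limUnder` is an arbitrary value if there is no limit, so convergence is
not presupposed here. -/
structure IsAlgorithmRun {K J N M : ℕ} (S : Network K J N M) (k : Fin K) (j : Fin J)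
    (e : Fin M → ℂ) (w₀ : CVec N)
    (w : ℕ → CVec N) (γ : ℕ → ℕ → ℝ) (xout : ℕ → ℕ → CVec N)
    (x : ℕ → ℕ → ℕ → CVec N) (s : ℕ → ℕ → ℕ → ℝ) : Prop where
  init : w 0 = w₀
  gamma_init : ∀ t, 0 < γ t 0
  inner_run : ∀ t l, IsAPGRun (S.Phi k j e (w t) (γ t l)) (S.surrogate k j e (w t)) S.Pmax
    (w t) (x t l) (s t l)
  inner_output : ∀ t l, xout t l = limUnder atTop (x t l)
  gamma_update : ∀ t l, γ t (l + 1) =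
    Real.sqrt (S.surrogate k j e (w t) (xout t l)) / S.totalPower (xout t l)
  outer_update : ∀ t, w (t + 1) = limUnder atTop (xout t)

end SecureRIS

end

/-! The run converges to a global maximizer of `objective`, which is more than the theorem asks.
Three convergence arguments are nested.

Inner loop: `Phi` is strictly concave where the surrogate is nonnegative, because the leakage is
strictly convex. The FISTA potential `IsAPGRun.energy_succ_le` drives the values to the maximum. On
a compact set with a unique maximizer, this forces the iterates to converge.

Middle loop: the quadratic transform is a Dinkelbach iteration in disguise
(`sub_le_of_isMax_quadraticTransform`). The ratios X/Y increase, and each increase bounds the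
squared change of the parameter. Hence the limiting ratio ρ satisfies max (X - ρY) = 0, an equation
with a unique maximizer (`quadraticTransform_tendsto`).

Outer loop: the surrogate lies below `f` and touches it at the base point. So `f / totalPower`
increases along the run, and every cluster point is a fixed point (`IsFixed`). The problem is
invariant under w ↦ cw with |c| = 1, so its solutions come in circles. Path following preserves the
phase u of ĥw, which selects one point of each circle. At phase u, |ĥw|/σ is a real linear
functional ⟪h, w⟫, and fixed points become solutions of `IsStationary`.

The heart is `IsStationary.unique`. A stationary point is a multiple of y = (B + m)⁻¹h for some m >
0. As m grows, the SNR ratio φ and the power fall while the coefficient nu of w in the stationarity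
equation rises. Energy-efficiency stationarity at two different m contradicts this. A global
maximizer rotated to phase u is itself a fixed point, hence the only cluster point, hence the limit.
-/

noncomputable section

namespace SecureRIS

/-! ### Concave functions and maximizing sequences -/

/-- A differentiable concave function lies below its tangent planes. -/
theorem concaveOn_le_add_inner_gradient {E : Type*} [NormedAddCommGroup E] [InnerProductSpace ℝ E]
    [CompleteSpace E] {D : Set E} {Φ : E → ℝ} (hΦ : ConcaveOn ℝ D Φ) {y z g : E} (hy : y ∈ D)
    (hz : z ∈ D) (hg : HasGradientAt Φ g y) : Φ z ≤ Φ y + inner ℝ g (z - y) := by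
  have hd : HasDerivAt (fun t : ℝ => Φ (y + t • (z - y))) (inner ℝ g (z - y)) 0 := by
    have h1 : HasDerivAt (fun t : ℝ => y + t • (z - y)) (z - y) 0 := by
      simpa using ((hasDerivAt_id (0 : ℝ)).smul_const (z - y)).const_add y
    have h2 : HasFDerivAt Φ (InnerProductSpace.toDual ℝ E g) (y + (0 : ℝ) • (z - y)) := by
      simpa using hg.hasFDerivAt
    have h3 := h2.comp_hasDerivAt (0 : ℝ) h1
    rw [InnerProductSpace.toDual_apply_apply] at h3
    exact h3
  have ht : Tendsto (slope (fun t : ℝ => Φ (y + t • (z - y))) 0) (𝓝[>] 0)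
      (𝓝 (inner ℝ g (z - y))) := by
    have := hd.hasDerivWithinAt (s := Set.Ioi 0)
    rwa [hasDerivWithinAt_iff_tendsto_slope' (by simp)] at this
  have hge : Φ z - Φ y ≤ inner ℝ g (z - y) := by
    refine ge_of_tendsto ht ?_
    filter_upwards [Ioo_mem_nhdsGT (zero_lt_one' ℝ)] with t ht
    have hc := hΦ.2 hy hz (sub_nonneg.2 ht.2.le) ht.1.le (by ring)
    have he : y + t • (z - y) = (1 - t) • y + t • z := by module
    simp only [slope_def_field, sub_zero, zero_smul, add_zero]
    rw [le_div_iff₀ ht.1, he]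
    simp only [smul_eq_mul] at hc
    linarith
  linarith

/-- A maximizing sequence in a compact set converges to a maximizer that is unique. -/
theorem tendsto_of_tendsto_unique_max {E : Type*} [TopologicalSpace E] {C : Set E}
    {Φ : E → ℝ} (hC : IsCompact C) (hΦ : ContinuousOn Φ C) {x : ℕ → E} {xs : E}
    (hx : ∀ i, x i ∈ C) (huniq : ∀ z ∈ C, Φ z = Φ xs → z = xs)
    (hlim : Tendsto (fun i => Φ (x i)) atTop (𝓝 (Φ xs))) : Tendsto x atTop (𝓝 xs) := by
  refine hC.tendsto_nhds_of_unique_mapClusterPt (Eventually.of_forall hx) ?_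
  intro z hz hcl
  refine huniq z hz ?_
  have h1 : MapClusterPt (Φ z) atTop (fun i => Φ (x i)) := by
    have hne : NeBot (𝓝 z ⊓ map x atTop) := hcl
    -- Continuity holds only within `C`, which is enough because the whole sequence lies in `C`.
    have ht : Tendsto Φ (𝓝 z ⊓ map x atTop) (𝓝 (Φ z) ⊓ map Φ (map x atTop)) := by
      refine tendsto_inf.2 ⟨?_, tendsto_map.mono_left inf_le_right⟩
      refine (hΦ z hz).tendsto.mono_left ?_
      refine inf_le_inf le_rfl ?_
      exact tendsto_principal.2 (Eventually.of_forall hx)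
    exact ht.neBot
  have hne : NeBot (𝓝 (Φ z) ⊓ map (fun i => Φ (x i)) atTop) := h1
  exact tendsto_nhds_unique (f := id) (l := 𝓝 (Φ z) ⊓ map (fun i => Φ (x i)) atTop)
    (tendsto_id.mono_left inf_le_left) (tendsto_id.mono_left (inf_le_right.trans hlim))

/-! ### Projection onto the ball and the momentum sequence -/

theorem projBall_mem {n : ℕ} {P : ℝ} (hP : 0 ≤ P) (v : CVec n) : ‖projBall P v‖ ^ 2 ≤ P := by
  unfold projBall
  split_ifs with h
  · exact h
  · have hv : ‖v‖ ≠ 0 := by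
      intro h0; apply h; rw [h0]; simpa using hP
    rw [norm_smul, Real.norm_of_nonneg (by positivity), div_mul_cancel₀ _ hv, Real.sq_sqrt hP]

/-- Variational inequality of the projection. Outside the ball the residual is a positive multiple
of `v`, and Cauchy-Schwarz bounds ⟪v, z⟫ by ‖v‖√P. -/
theorem inner_sub_projBall_le {n : ℕ} {P : ℝ} (hP : 0 ≤ P) (v z : CVec n) (hz : ‖z‖ ^ 2 ≤ P) :
    inner ℝ (v - projBall P v) (z - projBall P v) ≤ 0 := by
  unfold projBall
  split_ifs with h
  · simp
  · have hv : 0 < ‖v‖ := by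
      by_contra h0
      have h0' : ‖v‖ = 0 := le_antisymm (not_lt.1 h0) (norm_nonneg _)
      apply h; rw [h0']; simpa using hP
    have hlt : Real.sqrt P < ‖v‖ := (Real.sqrt_lt' hv).2 (not_le.1 h)
    have hzle : ‖z‖ ≤ Real.sqrt P := Real.le_sqrt_of_sq_le hz
    have e1 : v - (Real.sqrt P / ‖v‖) • v = (1 - Real.sqrt P / ‖v‖) • v := by module
    rw [e1, inner_smul_left, inner_sub_right, inner_smul_right, real_inner_self_eq_norm_sq]
    have h1 : inner ℝ v z ≤ ‖v‖ * Real.sqrt P :=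
      (real_inner_le_norm v z).trans (by gcongr)
    have h2 : Real.sqrt P / ‖v‖ * ‖v‖ ^ 2 = ‖v‖ * Real.sqrt P := by field_simp
    have h3 : 0 ≤ 1 - Real.sqrt P / ‖v‖ := by
      rw [sub_nonneg, div_le_one hv]; exact hlt.le
    rw [h2]
    exact mul_nonpos_of_nonneg_of_nonpos (by simpa using h3) (by linarith)

theorem one_le_momentum (i : ℕ) : 1 ≤ momentum i := by
  induction i with
  | zero => simp [momentum]
  | succ i ih =>
    have : (1 : ℝ) ≤ Real.sqrt (1 + 4 * momentum i ^ 2) := by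
      rw [Real.one_le_sqrt]; nlinarith [sq_nonneg (momentum i)]
    simp only [momentum]; linarith

/-- The recursion picks the root of this quadratic precisely so that the FISTA potential telescopes.
-/
theorem momentum_sq_sub (i : ℕ) :
    momentum (i + 1) ^ 2 - momentum (i + 1) = momentum i ^ 2 := by
  have := Real.sq_sqrt (show 0 ≤ 1 + 4 * momentum i ^ 2 by positivity)
  simp only [momentum]; nlinarith

theorem le_momentum (i : ℕ) : (i : ℝ) / 2 ≤ momentum i := by
  induction i with
  | zero => simp [momentum]
  | succ i ih =>
    have h1 := one_le_momentum i
    have : 2 * momentum i ≤ Real.sqrt (1 + 4 * momentum i ^ 2) :=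
      Real.le_sqrt_of_sq_le (by nlinarith)
    simp only [momentum]; push_cast; linarith

theorem tendsto_momentum : Tendsto momentum atTop atTop :=
  tendsto_atTop_mono le_momentum (tendsto_natCast_atTop_atTop.atTop_div_const two_pos)

/-! ### Convergence of the FISTA values -/

namespace IsAPGRun

variable {n : ℕ} {Φ X : CVec n → ℝ} {P : ℝ} {x₀ : CVec n} {x : ℕ → CVec n} {s : ℕ → ℝ}

theorem step_pos (h : IsAPGRun Φ X P x₀ x s) (i : ℕ) : 0 < s i := by
  obtain ⟨c, hc, hs⟩ := h.step_lower
  exact hc.trans_le (hs i)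

theorem init_pos (h : IsAPGRun Φ X P x₀ x s) : 0 < X x₀ := by
  have := h.dom 0
  rwa [extrapolate, h.init] at this

theorem norm_sq_le (h : IsAPGRun Φ X P x₀ x s) (h₀ : ‖x₀‖ ^ 2 ≤ P) (i : ℕ) : ‖x i‖ ^ 2 ≤ P := by
  cases i with
  | zero => rwa [h.init]
  | succ i =>
    rw [h.update]
    exact projBall_mem (le_trans (by positivity) h₀) _

theorem nonneg (h : IsAPGRun Φ X P x₀ x s) (i : ℕ) : 0 ≤ X (x i) := by
  cases i with
  | zero => rw [h.init]; exact h.init_pos.le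
  | succ i => exact h.armijo_dom i

/-- One proximal-gradient step compared with an arbitrary feasible point. -/
theorem prox_le (h : IsAPGRun Φ X P x₀ x s) (hP : 0 ≤ P) (hΦ : ConcaveOn ℝ {z | 0 ≤ X z} Φ)
    (hd : ∀ z, 0 < X z → DifferentiableAt ℝ Φ z) (i : ℕ) {z : CVec n} (hz : ‖z‖ ^ 2 ≤ P)
    (hXz : 0 ≤ X z) :
    2 * s i * Φ z + ‖x (i + 1) - z‖ ^ 2 - ‖extrapolate x i - z‖ ^ 2 ≤ 2 * s i * Φ (x (i + 1)) := by
  have hs := h.step_pos i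
  have hy := h.dom i
  set y := extrapolate x i with hy_def
  set g := gradient Φ y with hg
  -- Concavity, the Armijo condition and the projection inequality are added up. The extrapolated
  -- point may leave the ball, so concavity is used on all of {X ≥ 0}.
  have h1 := concaveOn_le_add_inner_gradient hΦ (y := y) (z := z) hy.le hXz (hd y hy).hasGradientAt
  rw [← hg] at h1
  have h2 := h.armijo i
  rw [← hy_def, ← hg] at h2
  have h3 := inner_sub_projBall_le hP (y + s i • g) z hz
  rw [← h.update i] at h3
  set x' := x (i + 1)
  have e1 : inner ℝ (y + s i • g - x') (z - x') =
      inner ℝ (y - x') (z - x') + s i * inner ℝ g (z - y) - s i * inner ℝ g (x' - y) := by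
    simp only [inner_sub_left, inner_sub_right, inner_add_left, inner_smul_left,
      RCLike.conj_to_real]
    ring
  have e2 : ‖y - z‖ ^ 2 = ‖x' - y‖ ^ 2 + ‖x' - z‖ ^ 2 - 2 * inner ℝ (y - x') (z - x') := by
    have : y - z = (y - x') - (z - x') := by abel
    rw [this, norm_sub_sq_real, norm_sub_rev y x', norm_sub_rev z x']; ring
  have h4 : s i * Φ z ≤ s i * (Φ y + inner ℝ g (z - y)) := by gcongr
  have h5 : s i * (Φ y + inner ℝ g (x' - y) - ‖x' - y‖ ^ 2 / (2 * s i)) ≤ s i * Φ x' := by gcongr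
  have e3 : s i * (Φ y + inner ℝ g (x' - y) - ‖x' - y‖ ^ 2 / (2 * s i)) =
    s i * Φ y + s i * inner ℝ g (x' - y) - ‖x' - y‖ ^ 2 / 2 := by field_simp
  rw [e3] at h5
  rw [e1] at h3
  rw [e2]
  linarith

/-- Nesterov's potential decreases: apply `prox_le` at a convex combination of the current iterate
and the maximizer, and multiply by a². -/
theorem energy_succ_le (h : IsAPGRun Φ X P x₀ x s) (h₀ : ‖x₀‖ ^ 2 ≤ P)
    (hΦ : ConcaveOn ℝ {z | 0 ≤ X z} Φ) (hd : ∀ z, 0 < X z → DifferentiableAt ℝ Φ z)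
    {xs : CVec n} (hxs : ‖xs‖ ^ 2 ≤ P) (hXs : 0 ≤ X xs)
    (hmax : ∀ z, ‖z‖ ^ 2 ≤ P → 0 ≤ X z → Φ z ≤ Φ xs) (i : ℕ) :
    2 * s (i + 1) * momentum (i + 1) ^ 2 * (Φ xs - Φ (x (i + 2)))
      + ‖momentum (i + 1) • x (i + 2) - (momentum (i + 1) - 1) • x (i + 1) - xs‖ ^ 2 ≤
    2 * s i * momentum i ^ 2 * (Φ xs - Φ (x (i + 1)))
      + ‖momentum i • x (i + 1) - (momentum i - 1) • x i - xs‖ ^ 2 := by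
  have hP : 0 ≤ P := le_trans (by positivity) h₀
  set a := momentum (i + 1) with ha
  have ha1 : 1 ≤ a := one_le_momentum _
  have ha0 : 0 < a := by linarith
  have hw0 : 0 ≤ 1 - 1 / a := by rw [sub_nonneg, div_le_one ha0]; exact ha1
  have hw1 : 0 ≤ 1 / a := by positivity
  have hw2 : 1 - 1 / a + 1 / a = 1 := by ring
  set z := (1 - 1 / a) • x (i + 1) + (1 / a) • xs with hz
  have hzX : 0 ≤ X z := hΦ.1 (h.nonneg (i + 1)) hXs hw0 hw1 hw2
  have hzP : ‖z‖ ^ 2 ≤ P := by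
    have hb := convex_closedBall (0 : CVec n) (Real.sqrt P)
    have hm : ∀ v : CVec n, v ∈ Metric.closedBall 0 (Real.sqrt P) ↔ ‖v‖ ^ 2 ≤ P := fun v => by
      rw [mem_closedBall_zero_iff, Real.le_sqrt (norm_nonneg _) hP]
    exact (hm _).1 (hb ((hm _).2 (h.norm_sq_le h₀ _)) ((hm _).2 hxs) hw0 hw1 hw2)
  have h1 := h.prox_le hP hΦ hd (i + 1) hzP hzX
  have h2 := hΦ.2 (h.nonneg (i + 1)) hXs hw0 hw1 hw2
  simp only [smul_eq_mul] at h2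
  have hs := h.step_pos (i + 1)
  have e1 : a • x (i + 2) - (a - 1) • x (i + 1) - xs = a • (x (i + 2) - z) := by
    rw [hz, smul_sub, smul_add, smul_smul, smul_smul, mul_sub, mul_one_div_cancel ha0.ne']
    module
  -- The extrapolation coefficient is chosen to make this identity hold, so that consecutive
  -- distance terms match.
  have e2 : momentum i • x (i + 1) - (momentum i - 1) • x i - xs =
      a • (extrapolate x (i + 1) - z) := by
    rw [hz, smul_sub, smul_add, smul_smul, smul_smul, mul_sub, mul_one_div_cancel ha0.ne',
      extrapolate, smul_add, smul_smul, mul_div_cancel₀ _ ha0.ne']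
    module
  rw [e1, e2, norm_smul, norm_smul, mul_pow, mul_pow, Real.norm_of_nonneg ha0.le]
  have h3 : a ^ 2 - a = momentum i ^ 2 := momentum_sq_sub i
  have h4 : 0 ≤ Φ xs - Φ (x (i + 1)) := sub_nonneg.2 (hmax _ (h.norm_sq_le h₀ _) (h.nonneg _))
  have h5 : s (i + 1) ≤ s i := h.step_antitone (Nat.le_succ i)
  -- Monotonicity of the step sizes enters here only.
  have h6 : 2 * s (i + 1) * momentum i ^ 2 * (Φ xs - Φ (x (i + 1))) ≤
      2 * s i * momentum i ^ 2 * (Φ xs - Φ (x (i + 1))) := by gcongr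
  have h7 := mul_le_mul_of_nonneg_left h1 (sq_nonneg a)
  have h8 := mul_le_mul_of_nonneg_left h2 (show 0 ≤ 2 * s (i + 1) * a ^ 2 by positivity)
  have e4 : 2 * s (i + 1) * a ^ 2 * ((1 - 1 / a) * Φ (x (i + 1)) + 1 / a * Φ xs) =
      2 * s (i + 1) * ((a ^ 2 - a) * Φ (x (i + 1)) + a * Φ xs) := by field_simp
  rw [e4, ← hz, h3] at h8
  have h9 : a = a ^ 2 - momentum i ^ 2 := by linarith
  have e5 : 2 * s (i + 1) * (momentum i ^ 2 * Φ (x (i + 1)) + a * Φ xs) =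
      2 * s (i + 1) * (momentum i ^ 2 * Φ (x (i + 1)) + (a ^ 2 - momentum i ^ 2) * Φ xs) := by
    rw [← h9]
  rw [e5] at h8
  nlinarith

/-- The objective values of an accelerated projected-gradient run converge to the maximum. -/
theorem tendsto_values (h : IsAPGRun Φ X P x₀ x s) (h₀ : ‖x₀‖ ^ 2 ≤ P)
    (hΦ : ConcaveOn ℝ {z | 0 ≤ X z} Φ) (hd : ∀ z, 0 < X z → DifferentiableAt ℝ Φ z)
    {xs : CVec n} (hxs : ‖xs‖ ^ 2 ≤ P) (hXs : 0 ≤ X xs)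
    (hmax : ∀ z, ‖z‖ ^ 2 ≤ P → 0 ≤ X z → Φ z ≤ Φ xs) :
    Tendsto (fun i => Φ (x i)) atTop (𝓝 (Φ xs)) := by
  obtain ⟨c, hc, hs⟩ := h.step_lower
  set E : ℕ → ℝ := fun i => 2 * s i * momentum i ^ 2 * (Φ xs - Φ (x (i + 1)))
      + ‖momentum i • x (i + 1) - (momentum i - 1) • x i - xs‖ ^ 2 with hE
  have hanti : Antitone E := antitone_nat_of_succ_le fun i =>
    h.energy_succ_le h₀ hΦ hd hxs hXs hmax i
  have hv : ∀ i, 0 ≤ Φ xs - Φ (x i) := fun i =>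
    sub_nonneg.2 (hmax _ (h.norm_sq_le h₀ _) (h.nonneg _))
  have hb : ∀ i, Φ xs - Φ (x (i + 1)) ≤ E 0 / (2 * c) * (momentum i ^ 2)⁻¹ := by
    intro i
    have ha := one_le_momentum i
    have h1 : E i ≤ E 0 := hanti (Nat.zero_le i)
    have h2 : 2 * c * momentum i ^ 2 * (Φ xs - Φ (x (i + 1))) ≤
        2 * s i * momentum i ^ 2 * (Φ xs - Φ (x (i + 1))) := by
      have := hv (i + 1)
      have := hs i
      gcongr
    have h3 : 2 * c * momentum i ^ 2 * (Φ xs - Φ (x (i + 1))) ≤ E 0 := by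
      refine (h2.trans ?_).trans h1
      simp only [hE]
      exact le_add_of_nonneg_right (by positivity)
    rw [div_mul_eq_mul_div, le_div_iff₀ (by positivity), ← div_eq_mul_inv,
      le_div_iff₀ (by positivity)]
    linarith
  have hlim : Tendsto (fun i => E 0 / (2 * c) * (momentum i ^ 2)⁻¹) atTop (𝓝 0) := by
    have := (tendsto_inv_atTop_zero.comp
      ((tendsto_pow_atTop two_ne_zero).comp tendsto_momentum)).const_mul (E 0 / (2 * c))
    simpa using this
  have h0 : Tendsto (fun i => Φ xs - Φ (x (i + 1))) atTop (𝓝 0) :=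
    squeeze_zero (fun i => hv (i + 1)) hb hlim
  rw [← tendsto_add_atTop_iff_nat 1]
  simpa using h0.const_sub (Φ xs)

end IsAPGRun

/-! ### Quadratic transform as a Dinkelbach iteration -/

section QuadraticTransform

variable {E : Type*} [NormedAddCommGroup E] [InnerProductSpace ℝ E] {X Y : E → ℝ}

/-- Strictness is inherited from X through strict monotonicity of √; concavity of √ and convexity of
Y supply the rest. -/
theorem strictConcaveOn_quadraticTransform (hX : StrictConcaveOn ℝ Set.univ X)
    (hY : ConvexOn ℝ Set.univ Y) {g : ℝ} (hg : 0 < g) :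
    StrictConcaveOn ℝ {z | 0 ≤ X z} (fun z => 2 * g * Real.sqrt (X z) - g ^ 2 * Y z) := by
  have hconv : Convex ℝ {z | 0 ≤ X z} := by
    simpa using hX.concaveOn.convex_ge 0
  refine ⟨hconv, ?_⟩
  intro x hx y hy hxy a b ha hb hab
  have h1 := hX.2 (Set.mem_univ x) (Set.mem_univ y) hxy ha hb hab
  have h2 := hY.2 (Set.mem_univ x) (Set.mem_univ y) ha.le hb.le hab
  have h3 := Real.strictConcaveOn_sqrt.concaveOn.2 (x := X x) (y := X y) hx hy ha.le hb.le hab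
  simp only [smul_eq_mul, Set.mem_ofPred_eq] at *
  have h4 : Real.sqrt (a * X x + b * X y) < Real.sqrt (X (a • x + b • y)) :=
    Real.sqrt_lt_sqrt (by positivity) h1
  have h5 := mul_lt_mul_of_pos_left (h3.trans_lt h4) (show 0 < 2 * g by positivity)
  have h6 := mul_le_mul_of_nonneg_left h2 (sq_nonneg g)
  linarith

theorem eq_of_strictConcaveOn_of_max {D : Set E} {F : E → ℝ} (hF : StrictConcaveOn ℝ D F)
    {C : Set E} (hC : Convex ℝ C) (hCD : C ⊆ D) {xs z : E} (hxs : xs ∈ C)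
    (hmax : ∀ z ∈ C, F z ≤ F xs) (hz : z ∈ C) (h : F z = F xs) : z = xs := by
  refine (hF.subset hCD hC).eq_of_isMaxOn ?_ hmax hz hxs
  intro y hy
  show F y ≤ F z
  rw [h]; exact hmax y hy

theorem convex_norm_sq_le (P : ℝ) : Convex ℝ {z : E | ‖z‖ ^ 2 ≤ P} := by
  have : ConvexOn ℝ Set.univ fun z : E => ‖z‖ ^ 2 :=
    convexOn_univ_norm.pow (fun z _ => norm_nonneg z) 2
  simpa using this.convex_le P

theorem isCompact_norm_sq_le [FiniteDimensional ℝ E] (P : ℝ) :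
    IsCompact {z : E | ‖z‖ ^ 2 ≤ P} := by
  have : ProperSpace E := FiniteDimensional.proper ℝ E
  refine (isCompact_closedBall (0 : E) (Real.sqrt P)).of_isClosed_subset
    (isClosed_le (by fun_prop) continuous_const) ?_
  intro z hz
  rw [mem_closedBall_zero_iff]
  exact Real.le_sqrt_of_sq_le hz

/-- A maximizer of the quadratic transform maximizes a parametric (Dinkelbach) objective. -/
theorem sub_le_of_isMax_quadraticTransform (hX : ConcaveOn ℝ Set.univ X)
    (hY : ConvexOn ℝ Set.univ Y) {g : ℝ} (hg : 0 < g) {P : ℝ} {xs : E}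
    (hxs : ‖xs‖ ^ 2 ≤ P) (hXs : 0 ≤ X xs)
    (hmax : ∀ z, ‖z‖ ^ 2 ≤ P → 0 ≤ X z →
      2 * g * Real.sqrt (X z) - g ^ 2 * Y z ≤ 2 * g * Real.sqrt (X xs) - g ^ 2 * Y xs)
    {z : E} (hz : ‖z‖ ^ 2 ≤ P) (hXz : 0 ≤ X z) :
    X z - X xs ≤ g * Real.sqrt (X xs) * (Y z - Y xs) := by
  -- First-order test along the segment from `xs` to `z`, with an explicit error of order t instead
  -- of derivatives, since √X can have infinite slope where X vanishes.
  have key : ∀ t : ℝ, 0 < t → t < 1 →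
      X z - X xs ≤ g * Real.sqrt (X xs) * (Y z - Y xs) + t * (g ^ 2 / 4 * (Y z - Y xs) ^ 2) := by
    intro t ht0 ht1
    have ht1' : 0 ≤ 1 - t := by linarith
    have hX1 := hX.2 (Set.mem_univ xs) (Set.mem_univ z) ht1' ht0.le (by ring)
    have hY1 := hY.2 (Set.mem_univ xs) (Set.mem_univ z) ht1' ht0.le (by ring)
    have hb : ‖(1 - t) • xs + t • z‖ ^ 2 ≤ P :=
      convex_norm_sq_le P hxs hz ht1' ht0.le (by ring)
    simp only [smul_eq_mul] at hX1 hY1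
    have hpos : 0 ≤ (1 - t) * X xs + t * X z := by positivity
    have h1 := hmax _ hb (hpos.trans hX1)
    have h2 : Real.sqrt ((1 - t) * X xs + t * X z) ≤ Real.sqrt (X ((1 - t) • xs + t • z)) :=
      Real.sqrt_le_sqrt hX1
    have h3 : g * (2 * (Real.sqrt ((1 - t) * X xs + t * X z) - Real.sqrt (X xs))) ≤
        g * (g * t * (Y z - Y xs)) := by
      have := mul_le_mul_of_nonneg_left hY1 (sq_nonneg g)
      have := mul_le_mul_of_nonneg_left h2 (show 0 ≤ 2 * g by positivity)
      nlinarith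
    have h4 := le_of_mul_le_mul_left h3 hg
    have h5 : Real.sqrt ((1 - t) * X xs + t * X z) ≤
      Real.sqrt (X xs) + g / 2 * t * (Y z - Y xs) := by linarith
    have h6 : (1 - t) * X xs + t * X z ≤ (Real.sqrt (X xs) + g / 2 * t * (Y z - Y xs)) ^ 2 := by
      rw [← Real.sq_sqrt hpos]
      exact pow_le_pow_left₀ (Real.sqrt_nonneg _) h5 2
    have h7 := Real.sq_sqrt hXs
    have h8 : t * (X z - X xs) ≤ t * (g * Real.sqrt (X xs) * (Y z - Y xs) +
        t * (g ^ 2 / 4 * (Y z - Y xs) ^ 2)) := by nlinarith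
    exact le_of_mul_le_mul_left h8 ht0
  have hlim : Tendsto (fun t : ℝ => g * Real.sqrt (X xs) * (Y z - Y xs) +
      t * (g ^ 2 / 4 * (Y z - Y xs) ^ 2)) (𝓝[>] 0)
      (𝓝 (g * Real.sqrt (X xs) * (Y z - Y xs) + 0 * (g ^ 2 / 4 * (Y z - Y xs) ^ 2))) := by
    refine Tendsto.mono_left ?_ nhdsWithin_le_nhds
    exact Continuous.tendsto (by fun_prop) 0
  rw [zero_mul, add_zero] at hlim
  refine ge_of_tendsto hlim ?_
  filter_upwards [Ioo_mem_nhdsGT (zero_lt_one' ℝ)] with t ht using key t ht.1 ht.2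

/-- A maximizer of the quadratic transform has positive numerator if some feasible point has. -/
theorem pos_of_isMax_quadraticTransform (hX : ConcaveOn ℝ Set.univ X)
    (hY : ConvexOn ℝ Set.univ Y) {g : ℝ} (hg : 0 < g) {P : ℝ} {xs : E}
    (hxs : ‖xs‖ ^ 2 ≤ P) (hXs : 0 ≤ X xs)
    (hmax : ∀ z, ‖z‖ ^ 2 ≤ P → 0 ≤ X z →
      2 * g * Real.sqrt (X z) - g ^ 2 * Y z ≤ 2 * g * Real.sqrt (X xs) - g ^ 2 * Y xs)
    {z : E} (hz : ‖z‖ ^ 2 ≤ P) (hXz : 0 < X z) : 0 < X xs := by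
  -- With a vanishing numerator, the parametric bound would give X z ≤ 0.
  refine hXs.lt_of_ne' fun h0 => ?_
  have := sub_le_of_isMax_quadraticTransform hX hY hg hxs hXs hmax hz hXz.le
  rw [h0] at this
  simp only [Real.sqrt_zero, mul_zero, zero_mul, sub_zero] at this
  linarith

/-- The exact quadratic-transform iteration converges to the maximizer of `X / Y` over a ball. -/
theorem quadraticTransform_tendsto [FiniteDimensional ℝ E] (hXc : Continuous X)
    (hX : StrictConcaveOn ℝ Set.univ X) (hYc : Continuous Y) (hY : ConvexOn ℝ Set.univ Y)
    {y₀ : ℝ} (hy₀ : 0 < y₀) (hYpos : ∀ z, y₀ ≤ Y z) {P : ℝ} {z₀ : E} (hz₀ : ‖z₀‖ ^ 2 ≤ P)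
    (hXz₀ : 0 < X z₀) {g : ℕ → ℝ} {x : ℕ → E} (hgpos : ∀ l, 0 < g l)
    (hmem : ∀ l, ‖x l‖ ^ 2 ≤ P) (hnn : ∀ l, 0 ≤ X (x l))
    (hmax : ∀ l z, ‖z‖ ^ 2 ≤ P → 0 ≤ X z →
      2 * g l * Real.sqrt (X z) - g l ^ 2 * Y z ≤
        2 * g l * Real.sqrt (X (x l)) - g l ^ 2 * Y (x l))
    (hg : ∀ l, g (l + 1) = Real.sqrt (X (x l)) / Y (x l)) :
    ∃ xs, ‖xs‖ ^ 2 ≤ P ∧ 0 < X xs ∧ Tendsto x atTop (𝓝 xs) ∧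
      ∀ z, ‖z‖ ^ 2 ≤ P → X z * Y xs ≤ X xs * Y z := by
  have hYp : ∀ z, 0 < Y z := fun z => hy₀.trans_le (hYpos z)
  have hXpos : ∀ l, 0 < X (x l) := fun l => pos_of_isMax_quadraticTransform hX.concaveOn hY
    (hgpos l) (hmem l) (hnn l) (hmax l) hz₀ hXz₀
  have hcmp : ∀ l z, ‖z‖ ^ 2 ≤ P → 0 ≤ X z →
      X z - X (x l) ≤ g l * Real.sqrt (X (x l)) * (Y z - Y (x l)) := fun l z h1 h2 =>
    sub_le_of_isMax_quadraticTransform hX.concaveOn hY (hgpos l) (hmem l) (hnn l)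
      (hmax l) h1 h2
  set r : ℕ → ℝ := fun l => X (x l) / Y (x l) with hr
  have hsq : ∀ l, Real.sqrt (X (x l)) = g (l + 1) * Y (x l) := fun l => by
    rw [hg, div_mul_cancel₀ _ (hYp _).ne']
  have hXg : ∀ l, X (x l) = (g (l + 1) * Y (x l)) ^ 2 := fun l => by
    rw [← hsq, Real.sq_sqrt (hnn l)]
  have hrg : ∀ l, r l = g (l + 1) ^ 2 * Y (x l) := fun l => by
    simp only [hr]; rw [hXg l]; field_simp [(hYp (x l)).ne']
  -- Test maximality of x (l+1) against x l: the left value is r l, the right one is r (l+1) - Y (g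
  -- (l+2) - g (l+1))². Indices start at l + 1 because `g 0` comes from no ratio.
  have hstep : ∀ l, y₀ * (g (l + 2) - g (l + 1)) ^ 2 ≤ r (l + 1) - r l := by
    intro l
    have h1 := hmax (l + 1) (x l) (hmem l) (hnn l)
    rw [hsq, hsq] at h1
    rw [hrg, hrg]
    have h2 : y₀ * (g (l + 2) - g (l + 1)) ^ 2 ≤ Y (x (l + 1)) * (g (l + 2) - g (l + 1)) ^ 2 := by
      gcongr; exact hYpos _
    nlinarith
  have hmono : Monotone r := monotone_nat_of_le_succ fun l => by
    have := hstep l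
    have h0 : 0 ≤ y₀ * (g (l + 2) - g (l + 1)) ^ 2 := by positivity
    linarith
  have hball : IsCompact {z : E | ‖z‖ ^ 2 ≤ P} := isCompact_norm_sq_le P
  obtain ⟨BX, hBX⟩ := hball.exists_bound_of_continuousOn hXc.continuousOn
  obtain ⟨BY, hBY⟩ := hball.exists_bound_of_continuousOn hYc.continuousOn
  have hXle : ∀ l, X (x l) ≤ BX := fun l => (le_abs_self _).trans (hBX _ (hmem l))
  have hYle : ∀ l, Y (x l) ≤ BY := fun l => (le_abs_self _).trans (hBY _ (hmem l))
  have hrle : ∀ l, r l ≤ BX / y₀ := fun l => by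
    simp only [hr]
    exact div_le_div₀ ((hnn l).trans (hXle l)) (hXle l) hy₀ (hYpos _)
  have hbdd : BddAbove (Set.range r) := ⟨BX / y₀, by rintro _ ⟨l, rfl⟩; exact hrle l⟩
  obtain ⟨rb, hrb⟩ : ∃ rb, Tendsto r atTop (𝓝 rb) := ⟨_, tendsto_atTop_ciSup hmono hbdd⟩
  have hrb1 : Tendsto (fun l => r (l + 1)) atTop (𝓝 rb) := hrb.comp (tendsto_add_atTop_nat 1)
  have hrpos : 0 < rb :=
    (div_pos (hXpos 0) (hYp _)).trans_le (hmono.ge_of_tendsto hrb 0)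
  -- the ratios and the Dinkelbach parameters have the same limit
  have hsqlim : Tendsto (fun l => (g (l + 2) - g (l + 1)) ^ 2) atTop (𝓝 0) := by
    have h1 : Tendsto (fun l => (r (l + 1) - r l) / y₀) atTop (𝓝 0) := by
      simpa using (hrb1.sub hrb).div_const y₀
    refine squeeze_zero (fun l => sq_nonneg _) (fun l => ?_) h1
    rw [le_div_iff₀ hy₀]; linarith [hstep l]
  have hglim : Tendsto (fun l => |g (l + 2) - g (l + 1)|) atTop (𝓝 0) := by
    have := hsqlim.sqrt
    simpa [Real.sqrt_sq_eq_abs] using this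
  have hdiff : Tendsto (fun l => r (l + 1) - g (l + 1) * Real.sqrt (X (x (l + 1)))) atTop
      (𝓝 0) := by
    have h1 : Tendsto (fun l => Real.sqrt BX * |g (l + 2) - g (l + 1)|) atTop (𝓝 0) := by
      simpa using hglim.const_mul (Real.sqrt BX)
    refine squeeze_zero_norm (fun l => ?_) h1
    have e : r (l + 1) - g (l + 1) * Real.sqrt (X (x (l + 1))) =
        Real.sqrt (X (x (l + 1))) * (g (l + 2) - g (l + 1)) := by
      rw [hrg, hsq]; ring
    rw [e, norm_mul, Real.norm_of_nonneg (Real.sqrt_nonneg _), Real.norm_eq_abs]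
    gcongr
    exact hXle _
  have hβ : Tendsto (fun l => g (l + 1) * Real.sqrt (X (x (l + 1)))) atTop (𝓝 rb) := by
    simpa using hrb1.sub hdiff
  -- Limit of the parametric inequalities. These only see X ≥ 0; negative X is trivial as `rb` > 0.
  have hnp : ∀ z, ‖z‖ ^ 2 ≤ P → X z - rb * Y z ≤ 0 := by
    intro z hz
    rcases lt_or_ge (X z) 0 with hneg | hXz
    · have := mul_pos hrpos (hYp z); linarith
    have h1 : Tendsto (fun l => X z - g (l + 1) * Real.sqrt (X (x (l + 1))) * Y z) atTop
        (𝓝 (X z - rb * Y z)) := (hβ.mul_const _).const_sub _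
    have h2 : Tendsto (fun l => BY * |r (l + 1) - g (l + 1) * Real.sqrt (X (x (l + 1)))|) atTop
        (𝓝 0) := by simpa using hdiff.abs.const_mul BY
    refine le_of_tendsto_of_tendsto' h1 h2 fun l => ?_
    have h3 := hcmp (l + 1) z hz hXz
    have h4 : X (x (l + 1)) = r (l + 1) * Y (x (l + 1)) := by
      simp only [hr]; rw [div_mul_cancel₀ _ (hYp _).ne']
    set D := r (l + 1) - g (l + 1) * Real.sqrt (X (x (l + 1))) with hD
    have h5 : X z - g (l + 1) * Real.sqrt (X (x (l + 1))) * Y z ≤ Y (x (l + 1)) * D := by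
      rw [hD]; linarith
    refine h5.trans ?_
    have h6 : Y (x (l + 1)) * D ≤ Y (x (l + 1)) * |D| :=
      mul_le_mul_of_nonneg_left (le_abs_self _) (hYp _).le
    refine h6.trans ?_
    gcongr
    exact hYle _
  have hval : Tendsto (fun l => X (x l) - rb * Y (x l)) atTop (𝓝 0) := by
    have h1 : Tendsto (fun l => BY * |r l - rb|) atTop (𝓝 0) := by
      simpa using (hrb.sub_const rb).abs.const_mul BY
    refine squeeze_zero_norm (fun l => ?_) h1
    have e : X (x l) - rb * Y (x l) = Y (x l) * (r l - rb) := by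
      simp only [hr]; field_simp [(hYp (x l)).ne']
    rw [e, norm_mul, Real.norm_of_nonneg (hYp _).le, Real.norm_eq_abs]
    gcongr
    exact hYle l
  have hWc : Continuous fun z => X z - rb * Y z := by fun_prop
  have hW : StrictConcaveOn ℝ Set.univ fun z => X z - rb * Y z := by
    refine hX.sub_convexOn ?_
    exact hY.smul hrpos.le
  obtain ⟨xs, hxs, hxsmax⟩ := hball.exists_isMaxOn ⟨z₀, hz₀⟩ hWc.continuousOn
  -- The iterates approach the value 0, which is also an upper bound, so they maximize X - rb Y
  -- asymptotically.
  have hxs0 : X xs - rb * Y xs = 0 :=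
    le_antisymm (hnp xs hxs) (le_of_tendsto' hval fun l => hxsmax (hmem l))
  refine ⟨xs, hxs, ?_, ?_, ?_⟩
  · have := mul_pos hrpos (hYp xs); linarith
  · refine tendsto_of_tendsto_unique_max hball hWc.continuousOn hmem
      (fun z hz he => eq_of_strictConcaveOn_of_max hW (convex_norm_sq_le P) (Set.subset_univ _)
        hxs (fun y hy => hxsmax hy) hz he) ?_
    rw [hxs0]; exact hval
  · intro z hz
    have h1 := hnp z hz
    have h2 : X xs = rb * Y xs := by linarith
    rw [h2]
    have := mul_le_mul_of_nonneg_right (sub_nonpos.1 h1) (hYp xs).le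
    linarith

end QuadraticTransform

/-- An accelerated projected-gradient run for the quadratic transform converges to a maximizer. -/
theorem IsAPGRun.exists_tendsto_max {n : ℕ} {X Y : CVec n → ℝ} (hXc : Continuous X)
    (hX : StrictConcaveOn ℝ Set.univ X) (hXd : Differentiable ℝ X)
    (hYc : Continuous Y) (hY : ConvexOn ℝ Set.univ Y) (hYd : Differentiable ℝ Y)
    {g P : ℝ} (hg : 0 < g) {x₀ : CVec n} (h₀ : ‖x₀‖ ^ 2 ≤ P) {x : ℕ → CVec n} {s : ℕ → ℝ}
    (h : IsAPGRun (fun z => 2 * g * Real.sqrt (X z) - g ^ 2 * Y z) X P x₀ x s) :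
    ∃ xs, Tendsto x atTop (𝓝 xs) ∧ ‖xs‖ ^ 2 ≤ P ∧ 0 ≤ X xs ∧
      ∀ z, ‖z‖ ^ 2 ≤ P → 0 ≤ X z →
        2 * g * Real.sqrt (X z) - g ^ 2 * Y z ≤ 2 * g * Real.sqrt (X xs) - g ^ 2 * Y xs := by
  set Φ : CVec n → ℝ := fun z => 2 * g * Real.sqrt (X z) - g ^ 2 * Y z with hΦ
  have hΦs : StrictConcaveOn ℝ {z | 0 ≤ X z} Φ := strictConcaveOn_quadraticTransform hX hY hg
  have hΦc : Continuous Φ := by fun_prop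
  have hC : IsCompact ({z : CVec n | ‖z‖ ^ 2 ≤ P} ∩ {z | 0 ≤ X z}) :=
    (isCompact_norm_sq_le P).inter_right (isClosed_le continuous_const hXc)
  have hCc : Convex ℝ ({z : CVec n | ‖z‖ ^ 2 ≤ P} ∩ {z | 0 ≤ X z}) :=
    (convex_norm_sq_le P).inter hΦs.1
  obtain ⟨xs, hxs, hmax⟩ := hC.exists_isMaxOn ⟨x₀, h₀, h.init_pos.le⟩ hΦc.continuousOn
  have hdiff : ∀ z, 0 < X z → DifferentiableAt ℝ Φ z := fun z hz =>
    (((hXd z).sqrt hz.ne').const_mul (2 * g)).sub ((hYd z).const_mul (g ^ 2))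
  have hv := h.tendsto_values h₀ hΦs.concaveOn hdiff hxs.1 hxs.2 fun z h1 h2 => hmax ⟨h1, h2⟩
  refine ⟨xs, ?_, hxs.1, hxs.2, fun z h1 h2 => hmax ⟨h1, h2⟩⟩
  exact tendsto_of_tendsto_unique_max hC hΦc.continuousOn
    (fun i => ⟨h.norm_sq_le h₀ i, h.nonneg i⟩)
    (fun z hz he => eq_of_strictConcaveOn_of_max hΦs hCc Set.inter_subset_right hxs
      (fun y hy => hmax hy) hz he) hv

/-! ### Uniqueness of the stationary point via resolvents -/

section Stationary

variable {E : Type*} [NormedAddCommGroup E] [InnerProductSpace ℝ E]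

/-- The resolvent identity paired with h; it makes ⟪h, y⟫ decrease in the shift. -/
theorem resolvent_inner_sub {B : E →ₗ[ℝ] E} (hsym : B.IsSymmetric) {h y₁ y₂ : E} {m₁ m₂ : ℝ}
    (h₁ : B y₁ + m₁ • y₁ = h) (h₂ : B y₂ + m₂ • y₂ = h) :
    inner ℝ h y₁ - inner ℝ h y₂ = (m₂ - m₁) * inner ℝ y₁ y₂ := by
  have e1 : inner ℝ h y₁ = inner ℝ (B y₂) y₁ + m₂ * inner ℝ y₂ y₁ := by
    rw [← h₂, inner_add_left, real_inner_smul_left]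
  have e2 : inner ℝ h y₂ = inner ℝ (B y₁) y₂ + m₁ * inner ℝ y₁ y₂ := by
    rw [← h₁, inner_add_left, real_inner_smul_left]
  rw [e1, e2, hsym y₁ y₂, real_inner_comm y₁ (B y₂), real_inner_comm y₁ y₂]
  ring

/-- Spectrally, m/(b + m) increases in m. Without a spectral decomposition: m₂ - m₁ times the gap is
⟪(B + m₂)d, B d⟫ ≥ 0 with d = y₁ - y₂. -/
theorem resolvent_mul_norm_sq_le {B : E →ₗ[ℝ] E}
    (hpos : ∀ x, 0 ≤ inner ℝ (B x) x) {h y₁ y₂ : E} {m₁ m₂ : ℝ} (hm₁ : 0 < m₁) (hm : m₁ < m₂)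
    (h₁ : B y₁ + m₁ • y₁ = h) (h₂ : B y₂ + m₂ • y₂ = h) :
    m₁ * ‖y₁‖ ^ 2 ≤ m₂ * inner ℝ y₁ y₂ := by
  have e1 : (m₂ - m₁) • y₁ = B (y₁ - y₂) + m₂ • (y₁ - y₂) := by
    rw [map_sub]; linear_combination (norm := module) (-1 : ℝ) • h₁ + (1 : ℝ) • h₂
  have e2 : m₂ • y₂ - m₁ • y₁ = B (y₁ - y₂) := by
    rw [map_sub]; linear_combination (norm := module) (1 : ℝ) • h₂ - (1 : ℝ) • h₁
  have e3 : m₂ * inner ℝ y₁ y₂ - m₁ * ‖y₁‖ ^ 2 = inner ℝ y₁ (B (y₁ - y₂)) := by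
    rw [← e2, inner_sub_right, inner_smul_right, inner_smul_right, real_inner_self_eq_norm_sq]
  have e4 : (m₂ - m₁) * inner ℝ y₁ (B (y₁ - y₂)) =
      ‖B (y₁ - y₂)‖ ^ 2 + m₂ * inner ℝ (B (y₁ - y₂)) (y₁ - y₂) := by
    rw [← real_inner_smul_left, e1, inner_add_left, real_inner_smul_left,
      real_inner_self_eq_norm_sq, real_inner_comm (B (y₁ - y₂))]
  have h0 : 0 ≤ (m₂ - m₁) * inner ℝ y₁ (B (y₁ - y₂)) := by
    rw [e4]
    have := mul_nonneg (hm₁.trans hm).le (hpos (y₁ - y₂))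
    positivity
  have := nonneg_of_mul_nonneg_right h0 (sub_pos.2 hm)
  linarith

/-- The gap is ⟪h, B d⟫, and (m₂ - m₁)h = (B + m₁)(B + m₂)d turns it into a sum of nonnegative
terms. -/
theorem resolvent_mul_inner_le {B : E →ₗ[ℝ] E}
    (hpos : ∀ x, 0 ≤ inner ℝ (B x) x) {h y₁ y₂ : E} {m₁ m₂ : ℝ} (hm₁ : 0 < m₁) (hm : m₁ < m₂)
    (h₁ : B y₁ + m₁ • y₁ = h) (h₂ : B y₂ + m₂ • y₂ = h) :
    m₁ * inner ℝ h y₁ ≤ m₂ * inner ℝ h y₂ := by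
  set d := y₁ - y₂ with hd
  have e1 : (m₂ - m₁) • y₁ = B d + m₂ • d := by
    rw [hd, map_sub]; linear_combination (norm := module) (-1 : ℝ) • h₁ + (1 : ℝ) • h₂
  have e2 : m₂ • y₂ - m₁ • y₁ = B d := by
    rw [hd, map_sub]; linear_combination (norm := module) (1 : ℝ) • h₂ - (1 : ℝ) • h₁
  have e3 : m₂ * inner ℝ h y₂ - m₁ * inner ℝ h y₁ = inner ℝ h (B d) := by
    rw [← e2, inner_sub_right, inner_smul_right, inner_smul_right]
  have e4 : (m₂ - m₁) • h = B (B d) + (m₂ + m₁) • B d + (m₁ * m₂) • d := by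
    calc (m₂ - m₁) • h = B ((m₂ - m₁) • y₁) + m₁ • ((m₂ - m₁) • y₁) := by
          rw [← h₁, map_smul]; module
      _ = _ := by rw [e1, map_add, map_smul]; module
  have e5 : (m₂ - m₁) * inner ℝ h (B d) = inner ℝ (B (B d)) (B d) + (m₂ + m₁) * ‖B d‖ ^ 2
      + m₁ * m₂ * inner ℝ (B d) d := by
    rw [← real_inner_smul_left, e4, inner_add_left, inner_add_left, real_inner_smul_left,
      real_inner_smul_left, real_inner_self_eq_norm_sq, real_inner_comm (B d) d]
  have h0 : 0 ≤ (m₂ - m₁) * inner ℝ h (B d) := by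
    rw [e5]
    have h1 := mul_nonneg (mul_pos hm₁ (hm₁.trans hm)).le (hpos d)
    have h2 := hpos (B d)
    have h3 : 0 ≤ (m₂ + m₁) * ‖B d‖ ^ 2 := by
      have := hm₁.trans hm
      positivity
    linarith
  have := nonneg_of_mul_nonneg_right h0 (sub_pos.2 hm)
  linarith

/-- Cauchy-Schwarz in `resolvent_mul_norm_sq_le`, then cancel ‖y₁‖. -/
theorem resolvent_sq_mul_norm_sq_le {B : E →ₗ[ℝ] E}
    (hpos : ∀ x, 0 ≤ inner ℝ (B x) x) {h y₁ y₂ : E} {m₁ m₂ : ℝ} (hm₁ : 0 < m₁) (hm : m₁ < m₂)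
    (h₁ : B y₁ + m₁ • y₁ = h) (h₂ : B y₂ + m₂ • y₂ = h) :
    m₁ ^ 2 * ‖y₁‖ ^ 2 ≤ m₂ ^ 2 * ‖y₂‖ ^ 2 := by
  have hm₂ := hm₁.trans hm
  have h3 := resolvent_mul_norm_sq_le hpos hm₁ hm h₁ h₂
  have h4 := real_inner_le_norm y₁ y₂
  have h5 : m₁ * ‖y₁‖ ≤ m₂ * ‖y₂‖ := by
    by_contra! hlt
    have h6 : 0 < ‖y₁‖ := by
      by_contra! h7
      have h8 : ‖y₁‖ = 0 := le_antisymm h7 (norm_nonneg _)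
      rw [h8, mul_zero] at hlt
      exact absurd hlt (not_lt.2 (by positivity))
    have h9 := mul_lt_mul_of_pos_right hlt h6
    nlinarith
  rw [← mul_pow, ← mul_pow]
  exact pow_le_pow_left₀ (by positivity) h5 2

/-- Stationarity, at a point of positive rate, of the Lagrangian of the energy efficiency
`log ((1 + ⟪h, w⟫²) / (1 + ⟪B w, w⟫)) / (c ‖w‖² + y₀)` on the ball `‖w‖² ≤ P`. -/
structure IsStationary (B : E →ₗ[ℝ] E) (h : E) (c y₀ P : ℝ) (w : E) (lam : ℝ) : Prop where
  signal_pos : 0 < inner ℝ h w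
  rate_pos : inner ℝ (B w) w < inner ℝ h w ^ 2
  mem : ‖w‖ ^ 2 ≤ P
  lam_nonneg : 0 ≤ lam
  compl : lam * (‖w‖ ^ 2 - P) = 0
  eq : (inner ℝ h w / (1 + inner ℝ h w ^ 2)) • h - (1 / (1 + inner ℝ (B w) w)) • B w =
    (c * Real.log ((1 + inner ℝ h w ^ 2) / (1 + inner ℝ (B w) w)) / (c * ‖w‖ ^ 2 + y₀) + lam) • w

/-- Stationary points are resolvent vectors: all their data are functions of the shift `m`. -/
theorem IsStationary.exists_resolvent {B : E →ₗ[ℝ] E}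
    (hpos : ∀ x, 0 ≤ inner ℝ (B x) x) {h : E} {c y₀ P : ℝ} {w : E} {lam : ℝ}
    (hw : IsStationary B h c y₀ P w lam) :
    ∃ (m φ nu : ℝ) (y : E), 0 < m ∧ 1 < φ ∧ 0 < nu ∧ 0 < ‖y‖ ^ 2 ∧ B y + m • y = h ∧
      inner ℝ h y = φ ∧
      nu = c * Real.log φ / (c * ‖w‖ ^ 2 + y₀) + lam ∧
      m * ‖w‖ ^ 2 = 1 - 1 / φ ∧ 1 / nu = 1 / (m * φ) + (φ - 1) / (m ^ 2 * ‖y‖ ^ 2) ∧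
      w = Real.sqrt (‖w‖ ^ 2 / ‖y‖ ^ 2) • y := by
  have hr := hw.signal_pos
  have hab := hw.rate_pos
  have hb := hpos w
  have heq := hw.eq
  set r := inner ℝ h w with hr_def
  set b := inner ℝ (B w) w with hb_def
  set φ := (1 + r ^ 2) / (1 + b) with hφ
  set nu := c * Real.log φ / (c * ‖w‖ ^ 2 + y₀) + lam with hnu
  have hb1 : 0 < 1 + b := by linarith
  have ha1 : 0 < 1 + r ^ 2 := by positivity
  have hφ1 : 1 < φ := by rw [hφ, lt_div_iff₀ hb1]; linarith
  have hφ0 : 0 < φ := by linarith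
  have hwne : w ≠ 0 := by
    rintro rfl
    rw [hr_def, inner_zero_right] at hr
    exact lt_irrefl _ hr
  have hp : 0 < ‖w‖ ^ 2 := by positivity
  have hφb : φ * (1 + b) = 1 + r ^ 2 := by rw [hφ, div_mul_cancel₀ _ hb1.ne']
  -- pairing the stationarity equation with `w`
  have hin : r ^ 2 / (1 + r ^ 2) - b / (1 + b) = nu * ‖w‖ ^ 2 := by
    have := congrArg (fun v => inner ℝ v w) heq
    simp only [inner_sub_left, real_inner_smul_left, real_inner_self_eq_norm_sq] at this
    rw [← hr_def, ← hb_def] at this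
    rw [← this]; ring
  have hin2 : nu * (1 + b) * ‖w‖ ^ 2 = 1 - 1 / φ := by
    have e : nu * (1 + b) * ‖w‖ ^ 2 = (1 + b) * (nu * ‖w‖ ^ 2) := by ring
    rw [e, ← hin, hφ]
    field_simp
    ring
  have hm0 : 0 < nu * (1 + b) := by
    have h1 : 0 < nu * (1 + b) * ‖w‖ ^ 2 := by
      rw [hin2, sub_pos, div_lt_one hφ0]; exact hφ1
    exact pos_of_mul_pos_left h1 hp.le
  have hnu0 : 0 < nu := pos_of_mul_pos_left hm0 hb1.le
  -- Solving the stationarity equation for h dictates this shift and the scaling φ/r of w.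
  set m := nu * (1 + b) with hm
  set y := (φ / r) • w with hy
  have hwy : w = (r / φ) • y := by
    rw [hy, smul_smul, div_mul_div_comm, mul_comm r φ, div_self (by positivity), one_smul]
  have hyn : ‖y‖ ^ 2 = (φ / r) ^ 2 * ‖w‖ ^ 2 := by
    rw [hy, norm_smul, mul_pow, Real.norm_eq_abs, sq_abs]
  have hyn0 : 0 < ‖y‖ ^ 2 := by rw [hyn]; positivity
  refine ⟨m, φ, nu, y, hm0, hφ1, hnu0, hyn0, ?_, ?_, rfl, hin2, ?_, ?_⟩
  · have e1 : (r / (1 + r ^ 2)) • h = (1 / (1 + b)) • B w + nu • w := by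
      linear_combination (norm := module) (1 : ℝ) • heq
    have e2 : h = ((1 + r ^ 2) / r) • ((1 / (1 + b)) • B w + nu • w) := by
      rw [← e1, smul_smul, div_mul_div_comm, mul_comm r, div_self (by positivity), one_smul]
    rw [e2, hy, map_smul, smul_add, smul_smul, smul_smul, smul_smul]
    congr 2
    · rw [hφ]; field_simp
    · rw [hm, hφ]; field_simp
  · rw [hy, inner_smul_right, ← hr_def, div_mul_cancel₀ _ hr.ne']
  · have e1 : r ^ 2 = m * ‖w‖ ^ 2 * φ + φ * b := by
      rw [hin2]; field_simp; linarith
    have e3 : m * ‖y‖ ^ 2 * r ^ 2 = φ * (φ - 1) := by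
      rw [hyn]; field_simp
      have := hin2
      field_simp at this
      linarith
    have e4 : 1 + b = 1 / φ + (φ - 1) / (m * ‖y‖ ^ 2) := by
      have : r ^ 2 = φ * (φ - 1) / (m * ‖y‖ ^ 2) := by
        rw [eq_div_iff (by positivity)]; linarith
      have e5 : 1 + b = (1 + r ^ 2) / φ := by rw [← hφb]; field_simp
      rw [e5, this]; field_simp
    have e6 : 1 / nu = (1 + b) / m := by rw [hm]; field_simp
    rw [e6, e4]; field_simp
  · have e : ‖w‖ ^ 2 / ‖y‖ ^ 2 = (r / φ) ^ 2 := by rw [hyn]; field_simp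
    rw [e, Real.sqrt_sq (by positivity)]; exact hwy

theorem eq_of_resolvent_eq {B : E →ₗ[ℝ] E} (hpos : ∀ x, 0 ≤ inner ℝ (B x) x) {h y₁ y₂ : E} {m : ℝ}
    (hm : 0 < m) (h₁ : B y₁ + m • y₁ = h) (h₂ : B y₂ + m • y₂ = h) : y₁ = y₂ := by
  have e : B (y₁ - y₂) + m • (y₁ - y₂) = 0 := by
    rw [map_sub]; linear_combination (norm := module) (1 : ℝ) • h₁ - (1 : ℝ) • h₂
  have e2 := congrArg (fun v => inner ℝ v (y₁ - y₂)) e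
  simp only [inner_add_left, real_inner_smul_left, inner_zero_left,
    real_inner_self_eq_norm_sq] at e2
  have h0 := hpos (y₁ - y₂)
  have h3 : ‖y₁ - y₂‖ ^ 2 = 0 := by
    have : m * ‖y₁ - y₂‖ ^ 2 ≤ 0 := by linarith
    exact le_antisymm (nonpos_of_mul_nonpos_right this hm) (by positivity)
  exact sub_eq_zero.1 (norm_eq_zero.1 (pow_eq_zero_iff two_ne_zero |>.1 h3))

/-- The stationary point of positive rate is unique. -/
theorem IsStationary.unique {B : E →ₗ[ℝ] E} (hsym : B.IsSymmetric)
    (hpos : ∀ x, 0 ≤ inner ℝ (B x) x) {h : E} {c y₀ P : ℝ} (hc : 0 ≤ c) (hy₀ : 0 < y₀)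
    {w₁ w₂ : E} {lam₁ lam₂ : ℝ} (hw₁ : IsStationary B h c y₀ P w₁ lam₁)
    (hw₂ : IsStationary B h c y₀ P w₂ lam₂) : w₁ = w₂ := by
  obtain ⟨m₁, φ₁, nu₁, y₁, hm₁, hφ₁, hnu₁, hy₁, hB₁, hφy₁, hnue₁, hp₁, hq₁, hwy₁⟩ :=
    hw₁.exists_resolvent hpos
  obtain ⟨m₂, φ₂, nu₂, y₂, hm₂, hφ₂, hnu₂, hy₂, hB₂, hφy₂, hnue₂, hp₂, hq₂, hwy₂⟩ :=
    hw₂.exists_resolvent hpos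
  wlog hle : m₁ ≤ m₂ generalizing w₁ w₂ lam₁ lam₂ m₁ m₂ φ₁ φ₂ nu₁ nu₂ y₁ y₂
  · exact (this hw₂ hw₁ m₂ φ₂ nu₂ y₂ hm₂ hφ₂ hnu₂ hy₂ hB₂ hφy₂ hnue₂ hp₂ hq₂ hwy₂
      m₁ φ₁ nu₁ y₁ hm₁ hφ₁ hnu₁ hy₁ hB₁ hφy₁ hnue₁ hp₁ hq₁ hwy₁ (not_le.1 hle).le).symm
  rcases hle.eq_or_lt with rfl | hlt
  · obtain rfl : y₁ = y₂ := eq_of_resolvent_eq hpos hm₁ hB₁ hB₂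
    obtain rfl : φ₁ = φ₂ := hφy₁.symm.trans hφy₂
    have : ‖w₁‖ ^ 2 = ‖w₂‖ ^ 2 := mul_left_cancel₀ hm₁.ne' (hp₁.trans hp₂.symm)
    rw [hwy₁, hwy₂, this]
  exfalso
  have hd := resolvent_inner_sub hsym hB₁ hB₂
  have hb := resolvent_mul_norm_sq_le hpos hm₁ hlt hB₁ hB₂
  have hcc := resolvent_mul_inner_le hpos hm₁ hlt hB₁ hB₂
  have hdd := resolvent_sq_mul_norm_sq_le hpos hm₁ hlt hB₁ hB₂
  rw [hφy₁, hφy₂] at hd hcc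
  set D₁ := ‖y₁‖ ^ 2
  set D₂ := ‖y₂‖ ^ 2
  set i := inner ℝ y₁ y₂
  set p₁ := ‖w₁‖ ^ 2 with hp₁_def
  set p₂ := ‖w₂‖ ^ 2 with hp₂_def
  have hi : 0 < i := by
    have : 0 < m₂ * i := (mul_pos hm₁ hy₁).trans_le hb
    exact pos_of_mul_pos_right this hm₂.le
  have hδ : 0 < m₂ - m₁ := sub_pos.2 hlt
  have hφlt : φ₂ < φ₁ := by have := mul_pos hδ hi; linarith
  have hφ₁0 : 0 < φ₁ := by linarith
  have hφ₂0 : 0 < φ₂ := by linarith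
  have hp₁e : p₁ = (1 - 1 / φ₁) / m₁ := by rw [eq_div_iff hm₁.ne']; linarith
  have hp₂e : p₂ = (1 - 1 / φ₂) / m₂ := by rw [eq_div_iff hm₂.ne']; linarith
  have hone : 1 - 1 / φ₂ < 1 - 1 / φ₁ := by
    have := one_div_lt_one_div_of_lt hφ₂0 hφlt
    linarith
  have hone2 : 0 < 1 - 1 / φ₂ := by rw [sub_pos, div_lt_one hφ₂0]; exact hφ₂
  have hplt : p₂ < p₁ := by
    rw [hp₁e, hp₂e]
    exact div_lt_div₀ hone hlt.le (by linarith) hm₁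
  -- The larger shift uses strictly less power, so its power constraint is inactive.
  have hlam₂ : lam₂ = 0 := by
    have h1 := hw₂.compl
    have h2 : ‖w₂‖ ^ 2 - P < 0 := by have := hw₁.mem; linarith
    exact (mul_eq_zero.1 h1).resolve_right h2.ne
  have hnu : nu₁ < nu₂ := by
    have h1 : 1 / (m₂ * φ₂) ≤ 1 / (m₁ * φ₁) := one_div_le_one_div_of_le (by positivity) hcc
    have h2 : (φ₂ - 1) / (m₂ ^ 2 * D₂) < (φ₁ - 1) / (m₁ ^ 2 * D₁) :=
      div_lt_div₀ (by linarith) hdd (by linarith) (by positivity)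
    have h3 : 1 / nu₂ < 1 / nu₁ := by rw [hq₁, hq₂]; linarith
    exact (one_div_lt_one_div hnu₂ hnu₁).1 h3
  -- A chord estimate: between the two points, log φ gains at least nu₁ per unit of power. The two
  -- summands of 1/nu₁ dominate the two summands of p₁ - p₂.
  have htan : nu₁ * (p₁ - p₂) ≤ (φ₁ - φ₂) / φ₁ := by
    have h1 : p₁ - p₂ ≤ (φ₁ - φ₂) / φ₁ * (1 / nu₁) := by
      have e1 : p₁ - p₂ = (φ₁ - 1) / φ₁ * ((m₂ - m₁) / (m₁ * m₂)) + (φ₁ - φ₂) / (m₂ * φ₁ * φ₂) := by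
        rw [hp₁e, hp₂e]; field_simp; ring
      have e2 : (φ₁ - φ₂) / φ₁ * (1 / nu₁) =
          (φ₁ - 1) / φ₁ * ((m₂ - m₁) * i / (m₁ ^ 2 * D₁)) + (φ₁ - φ₂) / (m₁ * φ₁ * φ₁) := by
        rw [hq₁, hd]; field_simp; ring
      rw [e1, e2]
      have e3 : (m₂ - m₁) / (m₁ * m₂) ≤ (m₂ - m₁) * i / (m₁ ^ 2 * D₁) := by
        rw [div_le_div_iff₀ (by positivity) (by positivity)]
        have := mul_le_mul_of_nonneg_left hb (mul_pos hδ hm₁).le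
        nlinarith
      have e4 : (φ₁ - φ₂) / (m₂ * φ₁ * φ₂) ≤ (φ₁ - φ₂) / (m₁ * φ₁ * φ₁) := by
        refine div_le_div_of_nonneg_left (by linarith) (by positivity) ?_
        have := mul_le_mul_of_nonneg_right hcc hφ₁0.le
        linarith
      have e5 : 0 ≤ (φ₁ - 1) / φ₁ := div_nonneg (by linarith) hφ₁0.le
      have := mul_le_mul_of_nonneg_left e3 e5
      linarith
    rw [mul_one_div, le_div_iff₀ hnu₁] at h1
    linarith
  have hlog : (φ₁ - φ₂) / φ₁ ≤ Real.log φ₁ - Real.log φ₂ := by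
    have := Real.log_le_sub_one_of_pos (div_pos hφ₂0 hφ₁0)
    rw [Real.log_div hφ₂0.ne' hφ₁0.ne'] at this
    rw [sub_div, div_self hφ₁0.ne']
    linarith
  have hL := htan.trans hlog
  have hp₂0 : 0 ≤ p₂ := by positivity
  have hp₁0 : 0 ≤ p₁ := by positivity
  have hY₁ : 0 < c * p₁ + y₀ := by positivity
  have hY₂ : 0 < c * p₂ + y₀ := by positivity
  have hρ : c * Real.log φ₁ / (c * p₁ + y₀) ≤ nu₁ := by
    rw [hnue₁]; linarith [hw₁.lam_nonneg]
  have hρ2 : c * Real.log φ₁ / (c * p₁ + y₀) * (p₁ - p₂) ≤ Real.log φ₁ - Real.log φ₂ :=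
    (mul_le_mul_of_nonneg_right hρ (by linarith)).trans hL
  -- The first point is at least as efficient, hence nu₂ = c log φ₂ / (c p₂ + y₀) ≤ nu₁, against nu₁
  -- < nu₂.
  have hcmp : Real.log φ₂ * (c * p₁ + y₀) ≤ Real.log φ₁ * (c * p₂ + y₀) := by
    rw [div_mul_eq_mul_div, div_le_iff₀ hY₁] at hρ2
    linarith
  have hnule : nu₂ ≤ c * Real.log φ₁ / (c * p₁ + y₀) := by
    rw [hnue₂, hlam₂, add_zero, div_le_div_iff₀ hY₂ hY₁]
    have := mul_le_mul_of_nonneg_left hcmp hc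
    linarith
  linarith

end Stationary

/-! ### Regularity of the network functions and the minorant property -/

namespace Network

variable {K J N M : ℕ} (S : Network K J N M)

/-- `w ↦ ĥ w` as a continuous linear functional -/
def hwL (k : Fin K) (e : Fin M → ℂ) : CVec N →L[ℂ] ℂ :=
  innerSL ℂ (WithLp.toLp 2 (star (S.hhat k e)) : CVec N)

/-- `w ↦ ΘHw` as a continuous linear map -/
def thetaL (e : Fin M → ℂ) : CVec N →L[ℂ] CVec M :=
  LinearMap.toContinuousLinearMap (Matrix.toLpLin 2 2 (S.ThetaH e))

/-- the coefficient of `‖ΘHw‖²` in the leakage -/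
def c₁ (k : Fin K) (j : Fin J) : ℝ := S.κ₁ j * Real.log (S.ε k)⁻¹

/-- the coefficient of `‖w‖²` in the leakage -/
def c₂ (k : Fin K) (j : Fin J) : ℝ := S.κ₂ j * Real.log (S.ε k)⁻¹

/-- the self-adjoint operator whose quadratic form is the leakage -/
def leakOp (k : Fin K) (j : Fin J) (e : Fin M → ℂ) : CVec N →L[ℝ] CVec N :=
  S.c₁ k j • (ContinuousLinearMap.adjoint ((S.thetaL e).restrictScalars ℝ) ∘L
    ((S.thetaL e).restrictScalars ℝ)) + S.c₂ k j • ContinuousLinearMap.id ℝ (CVec N)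

/-- the power consumed without transmission -/
def staticPower : ℝ := S.Pa + K * S.Pc + M * S.Ps

variable (k : Fin K) (j : Fin J) (e : Fin M → ℂ)

theorem hw_eq (w : CVec N) : S.hw k e w = S.hwL k e w := by
  simp only [hw, hwL, innerSL_apply_apply, PiLp.inner_apply, RCLike.inner_apply, Pi.star_apply]
  exact Finset.sum_congr rfl fun n _ => by simp [mul_comm]

theorem log_eps_pos : 0 < Real.log (S.ε k)⁻¹ :=
  Real.log_pos ((one_lt_inv₀ (S.ε_pos k)).2 (S.ε_lt_one k))

theorem c₁_pos : 0 < S.c₁ k j := by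
  have := S.log_eps_pos k
  have := S.α₁_pos
  have := S.αrE_pos j
  have := S.μr_pos j
  have := S.σE_pos j
  unfold c₁ κ₁
  positivity

theorem c₂_pos : 0 < S.c₂ k j := by
  have := S.log_eps_pos k
  have := S.αdE_pos j
  have := S.μd_pos j
  have := S.σE_pos j
  unfold c₂ κ₂
  positivity

theorem leak_eq (w : CVec N) :
    S.leak k j e w = S.c₁ k j * ‖S.thetaL e w‖ ^ 2 + S.c₂ k j * ‖w‖ ^ 2 := by
  have : S.thetaL e w = WithLp.toLp 2 (Matrix.mulVec (S.ThetaH e) (fun n => w n)) := rfl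
  rw [this, leak, c₁, c₂]
  ring

theorem inner_leakOp (w z : CVec N) : inner ℝ (S.leakOp k j e w) z =
    S.c₁ k j * inner ℝ (S.thetaL e w) (S.thetaL e z) + S.c₂ k j * inner ℝ w z := by
  simp [leakOp, inner_add_left, real_inner_smul_left, ContinuousLinearMap.adjoint_inner_left]

theorem leak_eq_inner (w : CVec N) : S.leak k j e w = inner ℝ (S.leakOp k j e w) w := by
  rw [inner_leakOp, leak_eq, real_inner_self_eq_norm_sq, real_inner_self_eq_norm_sq]

theorem leakOp_isSymmetric : (S.leakOp k j e : CVec N →ₗ[ℝ] CVec N).IsSymmetric := by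
  intro x y
  have h : inner ℝ x (S.leakOp k j e y) = inner ℝ (S.leakOp k j e y) x := real_inner_comm _ _
  have h1 := real_inner_comm (S.thetaL e x) (S.thetaL e y)
  rw [ContinuousLinearMap.coe_coe, h, inner_leakOp, inner_leakOp, h1, real_inner_comm x y]

theorem leak_nonneg (w : CVec N) : 0 ≤ S.leak k j e w := by
  have := S.c₁_pos k j
  have := S.c₂_pos k j
  rw [leak_eq]; positivity

theorem hw_smul (c : ℂ) (w : CVec N) : S.hw k e (c • w) = c * S.hw k e w := by
  simp [hw_eq]

theorem leak_smul {c : ℂ} (hc : ‖c‖ = 1) (w : CVec N) :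
    S.leak k j e (c • w) = S.leak k j e w := by
  simp [leak_eq, norm_smul, hc]

theorem totalPower_smul {c : ℂ} (hc : ‖c‖ = 1) (w : CVec N) :
    S.totalPower (c • w) = S.totalPower w := by
  simp [totalPower, norm_smul, hc]

theorem totalPower_eq (w : CVec N) : S.totalPower w = S.etaInv * ‖w‖ ^ 2 + S.staticPower := by
  simp only [totalPower, staticPower]; ring

theorem staticPower_pos : 0 < S.staticPower := S.static_pos

theorem staticPower_le (w : CVec N) : S.staticPower ≤ S.totalPower w := by
  have := S.etaInv_nonneg
  rw [totalPower_eq]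
  exact le_add_of_nonneg_left (by positivity)

theorem totalPower_pos (w : CVec N) : 0 < S.totalPower w :=
  S.staticPower_pos.trans_le (S.staticPower_le w)

@[fun_prop]
theorem continuous_hw : Continuous (S.hw k e) := by
  simp only [funext (S.hw_eq k e)]; fun_prop

@[fun_prop]
theorem continuous_leak : Continuous (S.leak k j e) := by
  simp only [funext (S.leak_eq k j e)]; fun_prop

@[fun_prop]
theorem continuous_totalPower : Continuous S.totalPower := by
  unfold totalPower; fun_prop

theorem convexOn_norm_sq_clm {E F : Type*} [NormedAddCommGroup E] [NormedSpace ℝ E]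
    [NormedAddCommGroup F] [NormedSpace ℝ F] (L : E →L[ℝ] F) :
    ConvexOn ℝ Set.univ fun z => ‖L z‖ ^ 2 := by
  have h := (convexOn_univ_norm (E := F)).pow (fun z _ => norm_nonneg z) 2
  exact h.comp_linearMap (L : E →ₗ[ℝ] F)

theorem convexOn_norm_sq : ConvexOn ℝ Set.univ fun z : CVec N => ‖z‖ ^ 2 :=
  convexOn_norm_sq_clm (ContinuousLinearMap.id ℝ (CVec N))

/-- The direct-link term c₂‖w‖² alone gives strong convexity; the rest is a convex quadratic form.
-/
theorem strictConvexOn_leak : StrictConvexOn ℝ Set.univ (S.leak k j e) := by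
  have h : StrongConvexOn Set.univ (2 * S.c₂ k j) (S.leak k j e) := by
    rw [strongConvexOn_iff_convex]
    have h1 := (convexOn_norm_sq_clm ((S.thetaL e).restrictScalars ℝ)).smul (S.c₁_pos k j).le
    refine h1.congr fun w _ => ?_
    simp only [smul_eq_mul, leak_eq, ContinuousLinearMap.coe_restrictScalars']
    ring
  exact h.strictConvexOn (by have := S.c₂_pos k j; positivity)

theorem convexOn_totalPower : ConvexOn ℝ Set.univ S.totalPower := by
  have h1 := ((convexOn_norm_sq (N := N)).smul S.etaInv_nonneg).add_const S.staticPower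
  refine h1.congr fun w _ => ?_
  simp [totalPower_eq]

theorem differentiable_hw : Differentiable ℝ (S.hw k e) := by
  simp only [funext (S.hw_eq k e)]
  exact ((S.hwL k e).restrictScalars ℝ).differentiable

theorem differentiable_totalPower : Differentiable ℝ S.totalPower := by
  have : Differentiable ℝ fun w : CVec N => ‖w‖ ^ 2 := differentiable_id.norm_sq ℝ
  unfold totalPower
  fun_prop

theorem differentiable_leak : Differentiable ℝ (S.leak k j e) := by
  have h1 : Differentiable ℝ fun w : CVec N => ‖w‖ ^ 2 := differentiable_id.norm_sq ℝ
  have h2 : Differentiable ℝ fun w : CVec N => ‖S.thetaL e w‖ ^ 2 :=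
    Differentiable.norm_sq ℝ ((S.thetaL e).restrictScalars ℝ).differentiable
  simp only [funext (S.leak_eq k j e)]
  fun_prop

theorem continuous_f : Continuous (S.f k j e) := by
  have hσ := S.σU_pos k
  unfold f Real.logb
  refine Continuous.div_const (Continuous.log ?_ fun w => ?_) _
  · refine Continuous.div (by fun_prop) (by fun_prop) fun w => ?_
    have := S.leak_nonneg k j e w
    positivity
  · have := S.leak_nonneg k j e w
    positivity

/-- Continuity in the base point is what lets the surrogate inequalities pass to cluster points of
the run. -/
theorem continuous_surrogate :
    Continuous fun p : CVec N × CVec N => S.surrogate k j e p.1 p.2 := by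
  have hσ := S.σU_pos k
  have h2 : 0 < Real.log 2 := Real.log_pos one_lt_two
  have c1 : Continuous fun p : CVec N × CVec N => S.hw k e p.1 :=
    (S.continuous_hw k e).comp continuous_fst
  have c2 : Continuous fun p : CVec N × CVec N => S.hw k e p.2 :=
    (S.continuous_hw k e).comp continuous_snd
  have c3 : Continuous fun p : CVec N × CVec N => S.leak k j e p.1 :=
    (S.continuous_leak k j e).comp continuous_fst
  have c4 : Continuous fun p : CVec N × CVec N => S.leak k j e p.2 :=
    (S.continuous_leak k j e).comp continuous_snd
  have c5 : Continuous fun p : CVec N × CVec N =>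
      (star (S.hw k e p.1) * S.hw k e p.2).re := Complex.continuous_re.comp (by fun_prop)
  unfold surrogate R₁ R₂ Real.logb
  refine Continuous.sub (Continuous.sub (Continuous.sub (Continuous.add ?_ ?_) ?_) ?_)
    (Continuous.add ?_ ?_)
  · exact (Continuous.log (by fun_prop) fun p => by positivity).div_const _
  · fun_prop
  · exact Continuous.div (by fun_prop) (by fun_prop) fun p => by positivity
  · fun_prop
  · exact (Continuous.log (by fun_prop) fun p => by
      have := S.leak_nonneg k j e p.1
      positivity).div_const _
  · exact Continuous.div (by fun_prop) (by fun_prop) fun p => by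
      have := S.leak_nonneg k j e p.1
      positivity

/-- the real linear functional `w ↦ Re (conj (ĥ v) ĥ w)` -/
def corrL (v : CVec N) : CVec N →L[ℝ] ℝ :=
  Complex.reCLM ∘L ((star (S.hw k e v) • S.hwL k e).restrictScalars ℝ)

theorem corrL_apply (v w : CVec N) :
    S.corrL k e v w = (star (S.hw k e v) * S.hw k e w).re := by
  simp [corrL, hw_eq]

/-- The surrogate is a constant plus a linear functional minus two quadratic forms. -/
theorem exists_surrogate_eq (v : CVec N) : ∃ a b p q : ℝ, 0 < b ∧ 0 ≤ p ∧ 0 < q ∧ ∀ w,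
    S.surrogate k j e v w =
      a + b * S.corrL k e v w - p * ‖S.hw k e w‖ ^ 2 - q * S.leak k j e w := by
  have hσ := S.σU_pos k
  have h2 : 0 < Real.log 2 := Real.log_pos one_lt_two
  have hl := S.leak_nonneg k j e v
  refine ⟨S.surrogate k j e v 0, 2 / (S.σU k ^ 2 * Real.log 2),
    ‖S.hw k e v‖ ^ 2 / ((S.σU k ^ 2 + ‖S.hw k e v‖ ^ 2) * S.σU k ^ 2 * Real.log 2),
    1 / ((1 + S.leak k j e v) * Real.log 2), by positivity, by positivity,
    by positivity, fun w => ?_⟩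
  have h0 : S.hw k e 0 = 0 := by simp [hw_eq]
  have h1 : S.leak k j e 0 = 0 := by simp [leak_eq]
  rw [corrL_apply]
  simp only [surrogate, R₁, R₂, h0, h1]
  simp only [mul_zero, Complex.zero_re, norm_zero]
  ring

theorem strictConcaveOn_surrogate (v : CVec N) :
    StrictConcaveOn ℝ Set.univ (S.surrogate k j e v) := by
  obtain ⟨a, b, p, q, -, hp, hq, heq⟩ := S.exists_surrogate_eq k j e v
  have h1 : ConcaveOn ℝ Set.univ fun w => a + (b • S.corrL k e v) w :=
    (concaveOn_const a convex_univ).add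
      (((b • S.corrL k e v : CVec N →L[ℝ] ℝ) : CVec N →ₗ[ℝ] ℝ).concaveOn convex_univ)
  have h2 := (convexOn_norm_sq_clm ((S.hwL k e).restrictScalars ℝ)).smul hp
  have h3 : StrictConvexOn ℝ Set.univ fun w => q • S.leak k j e w := by
    have := S.strictConvexOn_leak k j e
    refine ⟨this.1, fun x hx y hy hxy a b ha hb hab => ?_⟩
    have h := mul_lt_mul_of_pos_left (this.2 hx hy hxy ha hb hab) hq
    simp only [smul_eq_mul] at h ⊢
    linarith
  have h4 := (h1.sub h2).sub_strictConvexOn h3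
  refine h4.congr fun w _ => ?_
  simp [heq, hw_eq]

theorem differentiable_surrogate (v : CVec N) : Differentiable ℝ (S.surrogate k j e v) := by
  obtain ⟨a, b, p, q, -, hp, hq, heq⟩ := S.exists_surrogate_eq k j e v
  rw [funext heq]
  have h1 : Differentiable ℝ fun w : CVec N => ‖S.hw k e w‖ ^ 2 :=
    (S.differentiable_hw k e).norm_sq ℝ
  have h2 := S.differentiable_leak k j e
  fun_prop

theorem f_eq (w : CVec N) : S.f k j e w = Real.logb 2 (1 + ‖S.hw k e w‖ ^ 2 / S.σU k ^ 2)
    - Real.logb 2 (1 + S.leak k j e w) := by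
  have hσ := S.σU_pos k
  have hl := S.leak_nonneg k j e w
  rw [f, Real.logb_div (by positivity) (by positivity)]

theorem surrogate_self (w : CVec N) : S.surrogate k j e w w = S.f k j e w := by
  have hσ := S.σU_pos k
  have h2 : 0 < Real.log 2 := Real.log_pos one_lt_two
  have hre : (star (S.hw k e w) * S.hw k e w).re = ‖S.hw k e w‖ ^ 2 := by
    rw [Complex.star_def, ← Complex.normSq_eq_conj_mul_self, Complex.ofReal_re,
      Complex.normSq_eq_norm_sq]
  rw [f_eq, surrogate, R₁, R₂, hre]
  field_simp
  ring

/-- Both halves come from log x ≤ x - 1. For the signal part, Re ≤ modulus reduces the claim to two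
real amplitudes, where the gap is a perfect square over a positive denominator. -/
theorem surrogate_le_f (v w : CVec N) : S.surrogate k j e v w ≤ S.f k j e w := by
  have hσ := S.σU_pos k
  have h2 : 0 < Real.log 2 := Real.log_pos one_lt_two
  have hlv := S.leak_nonneg k j e v
  have hlw := S.leak_nonneg k j e w
  have hR₂ : Real.logb 2 (1 + S.leak k j e w) ≤ S.R₂ k j e v w := by
    have h := Real.log_le_sub_one_of_pos
      (show 0 < (1 + S.leak k j e w) / (1 + S.leak k j e v) by positivity)
    rw [Real.log_div (by positivity) (by positivity)] at h
    have e1 : (1 + S.leak k j e w) / (1 + S.leak k j e v) - 1 =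
        (S.leak k j e w - S.leak k j e v) / (1 + S.leak k j e v) := by field_simp; ring
    rw [R₂, Real.logb, Real.logb, ← div_div, ← add_div]
    gcongr
    linarith
  have hR₁ : S.R₁ k e v w ≤ Real.logb 2 (1 + ‖S.hw k e w‖ ^ 2 / S.σU k ^ 2) := by
    set zv := S.hw k e v
    set zw := S.hw k e w
    set σ := S.σU k
    have h := Real.log_le_sub_one_of_pos
      (show 0 < (1 + ‖zv‖ ^ 2 / σ ^ 2) / (1 + ‖zw‖ ^ 2 / σ ^ 2) by positivity)
    rw [Real.log_div (by positivity) (by positivity)] at h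
    have hre : (star zv * zw).re ≤ ‖zv‖ * ‖zw‖ := by
      have := Complex.re_le_norm (star zv * zw)
      rwa [norm_mul, norm_star] at this
    have e1 : S.R₁ k e v w = (Real.log (1 + ‖zv‖ ^ 2 / σ ^ 2) + 2 * (star zv * zw).re / σ ^ 2
        - (σ ^ 2 + ‖zw‖ ^ 2) * ‖zv‖ ^ 2 / ((σ ^ 2 + ‖zv‖ ^ 2) * σ ^ 2)
        - ‖zv‖ ^ 2 / σ ^ 2) / Real.log 2 := by
      rw [R₁, Real.logb, ← div_div _ _ (Real.log 2), ← div_div _ _ (Real.log 2),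
        ← div_div _ _ (Real.log 2), sub_div, sub_div, add_div]
    rw [e1, Real.logb]
    gcongr
    have h3 : 2 * (star zv * zw).re / σ ^ 2 ≤ 2 * (‖zv‖ * ‖zw‖) / σ ^ 2 := by gcongr
    set a := ‖zv‖
    set b := ‖zw‖
    have e2 : 2 * (a * b) / σ ^ 2 - (σ ^ 2 + b ^ 2) * a ^ 2 / ((σ ^ 2 + a ^ 2) * σ ^ 2)
        - a ^ 2 / σ ^ 2 ≤ 1 - (1 + a ^ 2 / σ ^ 2) / (1 + b ^ 2 / σ ^ 2) := by
      have e3 : 1 - (1 + a ^ 2 / σ ^ 2) / (1 + b ^ 2 / σ ^ 2) - (2 * (a * b) / σ ^ 2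
          - (σ ^ 2 + b ^ 2) * a ^ 2 / ((σ ^ 2 + a ^ 2) * σ ^ 2) - a ^ 2 / σ ^ 2) =
          (b * (σ ^ 2 + a ^ 2) - a * (σ ^ 2 + b ^ 2)) ^ 2 /
            (σ ^ 2 * (σ ^ 2 + a ^ 2) * (σ ^ 2 + b ^ 2)) := by
        field_simp
        ring
      rw [← sub_nonneg, e3]
      positivity
    linarith
  rw [f_eq, surrogate]
  linarith

end Network

/-! ### Multipliers on the ball and gradients at a fixed signal phase -/

/-- A linear functional maximal on a ball at a nonzero point is a nonnegative multiple of it. -/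
theorem exists_multiplier {E : Type*} [NormedAddCommGroup E] [InnerProductSpace ℝ E] {P : ℝ}
    {w G : E} (hw : w ≠ 0) (hmem : ‖w‖ ^ 2 ≤ P)
    (hG : ∀ z, ‖z‖ ^ 2 ≤ P → inner ℝ G (z - w) ≤ 0) :
    ∃ lam : ℝ, 0 ≤ lam ∧ lam * (‖w‖ ^ 2 - P) = 0 ∧ G = (2 * lam) • w := by
  rcases eq_or_ne G 0 with rfl | hG0
  · exact ⟨0, le_rfl, by simp, by simp⟩
  have hw0 : 0 < ‖w‖ := norm_pos_iff.2 hw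
  have hGn : 0 < ‖G‖ := norm_pos_iff.2 hG0
  have hP : 0 ≤ P := le_trans (by positivity) hmem
  have hwle : ‖w‖ ≤ Real.sqrt P := Real.le_sqrt_of_sq_le hmem
  -- The maximizer of ⟪G, ·⟫ on the ball, as test point, forces equality in Cauchy-Schwarz and an
  -- active constraint.
  have h1 := hG ((Real.sqrt P / ‖G‖) • G) (by
    rw [norm_smul, Real.norm_of_nonneg (by positivity), div_mul_cancel₀ _ hGn.ne',
      Real.sq_sqrt hP])
  rw [inner_sub_right, inner_smul_right, real_inner_self_eq_norm_sq] at h1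
  have e1 : Real.sqrt P / ‖G‖ * ‖G‖ ^ 2 = Real.sqrt P * ‖G‖ := by field_simp
  rw [e1] at h1
  have h2 := real_inner_le_norm G w
  have h3 : ‖w‖ = Real.sqrt P := by
    refine le_antisymm hwle ?_
    have : Real.sqrt P * ‖G‖ ≤ ‖w‖ * ‖G‖ := by linarith
    exact le_of_mul_le_mul_right this hGn
  have h4 : inner ℝ G w = ‖G‖ * ‖w‖ := le_antisymm h2 (by rw [h3]; linarith)
  rw [inner_eq_norm_mul_iff_real] at h4
  refine ⟨‖G‖ / ‖w‖ / 2, by positivity, ?_, ?_⟩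
  · rw [h3, Real.sq_sqrt hP, sub_self, mul_zero]
  · have : G = (1 / ‖w‖) • (‖w‖ • G) := by
      rw [smul_smul, one_div_mul_cancel hw0.ne', one_smul]
    calc G = (1 / ‖w‖) • (‖w‖ • G) := this
      _ = (1 / ‖w‖ * ‖G‖) • w := by rw [h4, smul_smul]
      _ = (2 * (‖G‖ / ‖w‖ / 2)) • w := by congr 1; ring

namespace Network

variable {K J N M : ℕ} (S : Network K J N M) (k : Fin K) (j : Fin J) (e : Fin M → ℂ)

/-- the real gradient of the aligned, noise-normalized signal amplitude `Re (conj u ĥ w) / σ` -/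
def signalVec (u : ℂ) : CVec N :=
  (InnerProductSpace.toDual ℝ (CVec N)).symm
    ((1 / S.σU k) • (Complex.reCLM ∘L ((star u • S.hwL k e).restrictScalars ℝ)))

theorem inner_signalVec (u : ℂ) (z : CVec N) :
    inner ℝ (S.signalVec k e u) z = (star u * S.hw k e z).re / S.σU k := by
  rw [signalVec, InnerProductSpace.toDual_symm_apply]
  simp [hw_eq]
  ring

theorem hasFDerivAt_norm_sq_hw (w : CVec N) : HasFDerivAt (fun z => ‖S.hw k e z‖ ^ 2)
    (2 • (innerSL ℝ (S.hw k e w) ∘L (S.hwL k e).restrictScalars ℝ)) w := by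
  have h : HasFDerivAt (S.hw k e) ((S.hwL k e).restrictScalars ℝ) w := by
    rw [funext (S.hw_eq k e)]
    exact ((S.hwL k e).restrictScalars ℝ).hasFDerivAt
  exact h.norm_sq

theorem hasFDerivAt_leak (w : CVec N) : HasFDerivAt (S.leak k j e)
    (2 • innerSL ℝ (S.leakOp k j e w)) w := by
  have h1 : HasFDerivAt (fun z => ‖S.thetaL e z‖ ^ 2)
      (2 • (innerSL ℝ (S.thetaL e w) ∘L (S.thetaL e).restrictScalars ℝ)) w :=
    ((S.thetaL e).restrictScalars ℝ).hasFDerivAt.norm_sq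
  have h2 : HasFDerivAt (fun z : CVec N => ‖z‖ ^ 2)
      (2 • (innerSL ℝ w ∘L ContinuousLinearMap.id ℝ (CVec N))) w :=
    (hasFDerivAt_id w).norm_sq
  rw [funext (S.leak_eq k j e)]
  refine ((h1.const_mul (S.c₁ k j)).add (h2.const_mul (S.c₂ k j))).congr_fderiv ?_
  ext z
  simp [inner_leakOp]
  ring

/-- At a point of phase u, |ĥw|²/σ² has the same gradient as the square of the real functional
⟪`signalVec`, ·⟫. This puts ∇f in the form of `IsStationary`. -/
theorem hasGradientAt_f {u : ℂ} {w : CVec N} (hw : S.hw k e w = ‖S.hw k e w‖ * u)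
    (hr : inner ℝ (S.signalVec k e u) w = ‖S.hw k e w‖ / S.σU k) :
    HasGradientAt (S.f k j e) ((2 / Real.log 2) •
      ((inner ℝ (S.signalVec k e u) w / (1 + inner ℝ (S.signalVec k e u) w ^ 2)) •
        S.signalVec k e u
      - (1 / (1 + inner ℝ (S.leakOp k j e w) w)) • S.leakOp k j e w)) w := by
  have hσ := S.σU_pos k
  have hl := S.leak_nonneg k j e w
  have h1 := ((((S.hasFDerivAt_norm_sq_hw k e w).mul_const (S.σU k ^ 2)⁻¹).const_add 1).log
    (by positivity)).mul_const (Real.log 2)⁻¹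
  have h2 := (((S.hasFDerivAt_leak k j e w).const_add 1).log (by positivity)).mul_const
    (Real.log 2)⁻¹
  have hf : S.f k j e = fun z => Real.log (1 + ‖S.hw k e z‖ ^ 2 * (S.σU k ^ 2)⁻¹) * (Real.log 2)⁻¹
      - Real.log (1 + S.leak k j e z) * (Real.log 2)⁻¹ := by
    funext z
    rw [f_eq]
    simp only [Real.logb, div_eq_mul_inv]
  rw [hasGradientAt_iff_hasFDerivAt, hf]
  refine (h1.sub h2).congr_fderiv ?_
  ext z
  rw [InnerProductSpace.toDual_apply_apply, real_inner_smul_left, inner_sub_left,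
    real_inner_smul_left, real_inner_smul_left, hr, inner_signalVec, ← leak_eq_inner]
  have hin : inner ℝ (S.hw k e w) (S.hwL k e z) = ‖S.hw k e w‖ * (star u * S.hw k e z).re := by
    rw [← hw_eq]
    have : inner ℝ (S.hw k e w) (S.hw k e z) = (star (S.hw k e w) * S.hw k e z).re := by
      rw [Complex.inner, mul_comm]; rfl
    rw [this]
    nth_rewrite 1 [hw]
    rw [star_mul', mul_assoc]
    simp
  simp [hin]
  field_simp

end Network

/-! ### Fixed points of the path-following map -/

namespace Network

variable {K J N M : ℕ} (S : Network K J N M) (k : Fin K) (j : Fin J) (e : Fin M → ℂ)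

/-- A fixed point, of positive rate and with signal phase `u`, of the map that sends `w` to the
maximizer over the ball of `surrogate w / totalPower`. -/
structure IsFixed (u : ℂ) (w : CVec N) : Prop where
  mem : ‖w‖ ^ 2 ≤ S.Pmax
  rate_pos : 0 < S.f k j e w
  phase : S.hw k e w = ‖S.hw k e w‖ * u
  max : ∀ z, ‖z‖ ^ 2 ≤ S.Pmax →
    S.surrogate k j e w z * S.totalPower w ≤ S.f k j e w * S.totalPower z

variable {S k j e}

theorem leak_lt_of_rate_pos {w : CVec N} (h : 0 < S.f k j e w) :
    S.leak k j e w < ‖S.hw k e w‖ ^ 2 / S.σU k ^ 2 := by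
  have hσ := S.σU_pos k
  have hl := S.leak_nonneg k j e w
  rw [f_eq, sub_pos, Real.logb_lt_logb_iff one_lt_two (by positivity) (by positivity)] at h
  linarith

theorem hw_ne_zero_of_rate_pos {w : CVec N} (h : 0 < S.f k j e w) : S.hw k e w ≠ 0 := by
  intro h0
  have := leak_lt_of_rate_pos h
  rw [h0] at this
  simp only [norm_zero] at this
  have := S.leak_nonneg k j e w
  norm_num at *
  linarith

namespace IsFixed

variable {u : ℂ} {w : CVec N}

theorem ne_zero (h : S.IsFixed k j e u w) : w ≠ 0 := by
  rintro rfl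
  exact hw_ne_zero_of_rate_pos h.rate_pos (by simp [hw_eq])

theorem inner_signalVec_eq (h : S.IsFixed k j e u w) (hu : ‖u‖ = 1) :
    inner ℝ (S.signalVec k e u) w = ‖S.hw k e w‖ / S.σU k := by
  rw [inner_signalVec]
  congr 1
  nth_rewrite 1 [h.phase]
  have : star u * (‖S.hw k e w‖ * u) = ((‖S.hw k e w‖ * ‖u‖ ^ 2 : ℝ) : ℂ) := by
    rw [mul_left_comm, Complex.star_def, Complex.conj_mul']
    push_cast; ring
  rw [this, Complex.ofReal_re, hu]
  ring

/-- At a fixed point the gradient of `f - ρ totalPower`, with `ρ = f w / totalPower w`, is a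
nonnegative multiple of `w`. -/
theorem exists_multiplier (h : S.IsFixed k j e u w) {G : CVec N}
    (hG : HasGradientAt (S.f k j e) G w) :
    ∃ lam : ℝ, 0 ≤ lam ∧ lam * (‖w‖ ^ 2 - S.Pmax) = 0 ∧
      G = (2 * (S.f k j e w / S.totalPower w * S.etaInv + lam)) • w := by
  set ρ := S.f k j e w / S.totalPower w with hρ
  have hY := S.totalPower_pos w
  -- the surrogate touches `f` from below
  have hX : HasFDerivAt (S.surrogate k j e w) (InnerProductSpace.toDual ℝ _ G) w := by
    have h1 := (S.differentiable_surrogate k j e w w).hasFDerivAt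
    have h2 := hG.hasFDerivAt.sub h1
    have h3 : IsLocalMin (fun z => S.f k j e z - S.surrogate k j e w z) w := by
      refine Eventually.of_forall fun z => ?_
      show S.f k j e w - S.surrogate k j e w w ≤ _
      rw [surrogate_self, sub_self, sub_nonneg]
      exact S.surrogate_le_f k j e w z
    have h4 := h3.hasFDerivAt_eq_zero h2
    rw [sub_eq_zero.1 h4]
    exact h1
  have hn : HasFDerivAt (fun z : CVec N => ‖z‖ ^ 2)
      (2 • (innerSL ℝ w ∘L ContinuousLinearMap.id ℝ (CVec N))) w := (hasFDerivAt_id w).norm_sq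
  have hF : HasFDerivAt (fun z => S.surrogate k j e w z
      - ρ * (S.etaInv * ‖z‖ ^ 2 + S.staticPower))
      (InnerProductSpace.toDual ℝ _ (G - (2 * (ρ * S.etaInv)) • w)) w := by
    refine (hX.sub (((hn.const_mul S.etaInv).add_const S.staticPower).const_mul ρ)).congr_fderiv ?_
    ext z
    simp
    ring
  have hmax : IsLocalMaxOn (fun z => S.surrogate k j e w z
      - ρ * (S.etaInv * ‖z‖ ^ 2 + S.staticPower)) {z | ‖z‖ ^ 2 ≤ S.Pmax} w := by
    refine IsMaxOn.localize fun z hz => ?_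
    show S.surrogate k j e w z - _ ≤ S.surrogate k j e w w - _
    rw [← totalPower_eq, ← totalPower_eq, surrogate_self]
    have h1 := h.max z hz
    have h2 : ρ * S.totalPower w = S.f k j e w := by rw [hρ, div_mul_cancel₀ _ hY.ne']
    have h3 : S.surrogate k j e w z ≤ ρ * S.totalPower z := by
      rw [hρ, div_mul_eq_mul_div, le_div_iff₀ hY]; exact h1
    linarith
  obtain ⟨lam, hlam, hcompl, heq⟩ := SecureRIS.exists_multiplier h.ne_zero h.mem
    (G := G - (2 * (ρ * S.etaInv)) • w) fun z hz => by
      have := hmax.hasFDerivWithinAt_nonpos hF.hasFDerivWithinAt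
        (sub_mem_posTangentConeAt_of_segment_subset
          ((convex_norm_sq_le S.Pmax).segment_subset h.mem hz))
      rwa [InnerProductSpace.toDual_apply_apply] at this
  refine ⟨lam, hlam, hcompl, ?_⟩
  rw [sub_eq_iff_eq_add] at heq
  rw [heq]
  module

/-- The multiplier identity scaled by (log 2)/2, which passes from base-2 to natural logarithms and
removes the 2 from differentiating squares. -/
theorem isStationary (h : S.IsFixed k j e u w) (hu : ‖u‖ = 1) : ∃ lam, IsStationary
    (S.leakOp k j e : CVec N →ₗ[ℝ] CVec N) (S.signalVec k e u) S.etaInv S.staticPower S.Pmax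
    w lam := by
  have h2 : 0 < Real.log 2 := Real.log_pos one_lt_two
  have hσ := S.σU_pos k
  have hr := h.inner_signalVec_eq hu
  have hG := S.hasGradientAt_f k j e h.phase hr
  obtain ⟨lam, hlam, hcompl, heq⟩ := h.exists_multiplier hG
  have hne : 0 < ‖S.hw k e w‖ := norm_pos_iff.2 (hw_ne_zero_of_rate_pos h.rate_pos)
  refine ⟨Real.log 2 * lam, ?_, ?_, h.mem, by positivity, by rw [mul_assoc, hcompl, mul_zero], ?_⟩
  · rw [hr]; positivity
  · rw [ContinuousLinearMap.coe_coe, ← leak_eq_inner, hr, div_pow]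
    exact leak_lt_of_rate_pos h.rate_pos
  · have hlog : Real.log ((1 + inner ℝ (S.signalVec k e u) w ^ 2) /
        (1 + inner ℝ (S.leakOp k j e w) w)) = Real.log 2 * S.f k j e w := by
      rw [f, Real.logb, mul_div_cancel₀ _ h2.ne', hr, ← leak_eq_inner, div_pow]
    rw [ContinuousLinearMap.coe_coe, hlog, ← totalPower_eq]
    have h3 := congrArg (fun v => (Real.log 2 / 2) • v) heq
    simp only [smul_smul] at h3
    rw [show Real.log 2 / 2 * (2 / Real.log 2) = 1 by field_simp, one_smul] at h3
    rw [h3]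
    congr 1
    ring

theorem unique (hu : ‖u‖ = 1) {w' : CVec N} (h : S.IsFixed k j e u w)
    (h' : S.IsFixed k j e u w') : w = w' := by
  obtain ⟨_, hs⟩ := h.isStationary hu
  obtain ⟨_, hs'⟩ := h'.isStationary hu
  refine hs.unique (S.leakOp_isSymmetric k j e) (fun x => ?_) S.etaInv_nonneg S.staticPower_pos hs'
  rw [ContinuousLinearMap.coe_coe, ← leak_eq_inner]
  exact S.leak_nonneg k j e x

/-- Positive rate makes the positive part invisible near w; the quotient rule divides the multiplier
by `totalPower`. -/
theorem isKKTPoint (h : S.IsFixed k j e u w) (hu : ‖u‖ = 1) : S.IsKKTPoint k j e w := by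
  have hY := S.totalPower_pos w
  have hr := h.inner_signalVec_eq hu
  have hG := S.hasGradientAt_f k j e h.phase hr
  obtain ⟨lam, hlam, hcompl, heq⟩ := h.exists_multiplier hG
  refine ⟨h.mem, lam / S.totalPower w, by positivity, by
    rw [div_mul_eq_mul_div, hcompl, zero_div], ?_⟩
  rw [heq] at hG
  have hn : HasFDerivAt (fun z : CVec N => ‖z‖ ^ 2)
      (2 • (innerSL ℝ w ∘L ContinuousLinearMap.id ℝ (CVec N))) w := (hasFDerivAt_id w).norm_sq
  have hYd := (hn.const_mul S.etaInv).add_const S.staticPower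
  have hY' : S.etaInv * ‖w‖ ^ 2 + S.staticPower ≠ 0 := by rw [← totalPower_eq]; exact hY.ne'
  have hq := hG.hasFDerivAt.mul ((hasDerivAt_inv hY').comp_hasFDerivAt w hYd)
  have hev : (fun v : CVec N => S.objective k j e v
      - lam / S.totalPower w * (‖v‖ ^ 2 - S.Pmax)) =ᶠ[𝓝 w]
      fun v => S.f k j e v * (S.etaInv * ‖v‖ ^ 2 + S.staticPower)⁻¹
      - lam / S.totalPower w * (‖v‖ ^ 2 - S.Pmax) := by
    filter_upwards [(S.continuous_f k j e).continuousAt.eventually (lt_mem_nhds h.rate_pos)]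
      with v hv
    rw [objective, max_eq_left hv.le, totalPower_eq, div_eq_mul_inv]
  rw [hasGradientAt_iff_hasFDerivAt]
  refine HasFDerivAt.congr_of_eventuallyEq ?_ hev
  refine (hq.sub ((hn.sub_const S.Pmax).const_mul (lam / S.totalPower w))).congr_fderiv ?_
  ext z
  have hYne := hY.ne'
  simp
  rw [← totalPower_eq]
  field_simp
  ring

end IsFixed

/-- Every global maximizer of positive rate can be rotated into a fixed point of given phase. -/
theorem exists_isFixed_isMaxOn {u : ℂ} (hu : ‖u‖ = 1) {w₀ : CVec N} (hw₀ : ‖w₀‖ ^ 2 ≤ S.Pmax)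
    (hf₀ : 0 < S.f k j e w₀) :
    ∃ w, S.IsFixed k j e u w ∧ IsMaxOn (S.objective k j e) S.feasible w := by
  have hcont : Continuous (S.objective k j e) := by
    unfold objective
    exact ((S.continuous_f k j e).max continuous_const).div (S.continuous_totalPower)
      fun w => (S.totalPower_pos w).ne'
  obtain ⟨v, hv, hmax⟩ := (isCompact_norm_sq_le (E := CVec N) S.Pmax).exists_isMaxOn ⟨w₀, hw₀⟩
    hcont.continuousOn
  have hfv : 0 < S.f k j e v := by
    have h1 : S.objective k j e w₀ ≤ S.objective k j e v := hmax hw₀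
    have h2 : 0 < S.objective k j e w₀ := by
      rw [objective, max_eq_left hf₀.le]
      exact div_pos hf₀ (S.totalPower_pos _)
    by_contra! h3
    rw [objective, objective, max_eq_right h3, zero_div] at *
    linarith
  have hh := norm_pos_iff.2 (hw_ne_zero_of_rate_pos hfv)
  -- This unit factor rotates ĥv to phase u and leaves the objective and the norm unchanged.
  set c : ℂ := u * (star (S.hw k e v) / ‖S.hw k e v‖) with hc
  have hcn : ‖c‖ = 1 := by
    rw [hc, norm_mul, hu, norm_div, norm_star, Complex.norm_real, norm_norm, div_self hh.ne',
      one_mul]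
  have hhw : S.hw k e (c • v) = ‖S.hw k e v‖ * u := by
    rw [hw_smul, hc]
    have : star (S.hw k e v) * S.hw k e v = (‖S.hw k e v‖ : ℂ) ^ 2 := by
      rw [Complex.star_def, Complex.conj_mul']
    have hne : (‖S.hw k e v‖ : ℂ) ≠ 0 := by exact_mod_cast hh.ne'
    field_simp
    rw [mul_assoc, this]
  have hnorm : ‖S.hw k e (c • v)‖ = ‖S.hw k e v‖ := by
    rw [hw_smul, norm_mul, hcn, one_mul]
  have hf : S.f k j e (c • v) = S.f k j e v := by
    rw [f, f, hnorm, leak_smul _ _ _ _ hcn]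
  have hobj : S.objective k j e (c • v) = S.objective k j e v := by
    rw [objective, objective, hf, totalPower_smul _ hcn]
  have hmax' : IsMaxOn (S.objective k j e) S.feasible (c • v) := fun z hz => by
    show S.objective k j e z ≤ S.objective k j e (c • v)
    rw [hobj]; exact hmax hz
  refine ⟨c • v, ⟨?_, by rwa [hf], by rw [hnorm, hhw], fun z hz => ?_⟩, hmax'⟩
  · rw [norm_smul, hcn, one_mul]; exact hv
  · have h1 : S.objective k j e z ≤ S.objective k j e (c • v) := hmax' hz
    rw [objective, objective, max_eq_left (hfv.le.trans_eq hf.symm),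
      div_le_div_iff₀ (S.totalPower_pos _) (S.totalPower_pos _)] at h1
    -- Since the surrogate lies below f, global maximality implies the fixed-point inequality.
    refine le_trans ?_ h1
    exact mul_le_mul_of_nonneg_right ((S.surrogate_le_f k j e _ z).trans (le_max_left _ _))
      (S.totalPower_pos _).le

end Network

/-! ### Convergence of the nested loops -/

namespace IsAlgorithmRun

variable {K J N M : ℕ} {S : Network K J N M} {k : Fin K} {j : Fin J} {e : Fin M → ℂ}
  {w₀ : CVec N} {w : ℕ → CVec N} {γ : ℕ → ℕ → ℝ} {xout : ℕ → ℕ → CVec N}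
  {x : ℕ → ℕ → ℕ → CVec N} {s : ℕ → ℕ → ℕ → ℝ}

theorem rate_pos (h : IsAlgorithmRun S k j e w₀ w γ xout x s) (t : ℕ) : 0 < S.f k j e (w t) := by
  rw [← S.surrogate_self]
  exact (h.inner_run t 0).init_pos

/-- The inner loops of one path-following step. -/
theorem step (h : IsAlgorithmRun S k j e w₀ w γ xout x s) {t : ℕ} (hw : ‖w t‖ ^ 2 ≤ S.Pmax) :
    (∀ l, Tendsto (x t l) atTop (𝓝 (xout t l))) ∧ Tendsto (xout t) atTop (𝓝 (w (t + 1))) ∧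
    ‖w (t + 1)‖ ^ 2 ≤ S.Pmax ∧
    ∀ z, ‖z‖ ^ 2 ≤ S.Pmax → S.surrogate k j e (w t) z * S.totalPower (w (t + 1)) ≤
      S.surrogate k j e (w t) (w (t + 1)) * S.totalPower z := by
  have hXc : Continuous (S.surrogate k j e (w t)) :=
    (S.differentiable_surrogate k j e (w t)).continuous
  have hX := S.strictConcaveOn_surrogate k j e (w t)
  have hY := S.convexOn_totalPower
  have hX₀ : 0 < S.surrogate k j e (w t) (w t) := (h.inner_run t 0).init_pos
  have hinner : ∀ l, 0 < γ t l → Tendsto (x t l) atTop (𝓝 (xout t l)) ∧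
      ‖xout t l‖ ^ 2 ≤ S.Pmax ∧ 0 ≤ S.surrogate k j e (w t) (xout t l) ∧
      ∀ z, ‖z‖ ^ 2 ≤ S.Pmax → 0 ≤ S.surrogate k j e (w t) z →
        2 * γ t l * Real.sqrt (S.surrogate k j e (w t) z) - γ t l ^ 2 * S.totalPower z ≤
        2 * γ t l * Real.sqrt (S.surrogate k j e (w t) (xout t l))
          - γ t l ^ 2 * S.totalPower (xout t l) := by
    intro l hl
    have hrun : IsAPGRun (fun z => 2 * γ t l * Real.sqrt (S.surrogate k j e (w t) z)
        - γ t l ^ 2 * S.totalPower z) (S.surrogate k j e (w t)) S.Pmax (w t) (x t l) (s t l) :=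
      h.inner_run t l
    obtain ⟨xs, h1, h2⟩ := IsAPGRun.exists_tendsto_max hXc hX
      (S.differentiable_surrogate k j e (w t)) S.continuous_totalPower hY
      S.differentiable_totalPower hl hw hrun
    have : xout t l = xs := by rw [h.inner_output, h1.limUnder_eq]
    rw [this]
    exact ⟨h1, h2⟩
  -- Positivity propagates: a positive parameter gives a maximizer of positive surrogate, hence a
  -- positive next parameter.
  have hγ : ∀ l, 0 < γ t l := by
    intro l
    induction l with
    | zero => exact h.gamma_init t
    | succ l ih =>
      obtain ⟨-, h1, h2, h3⟩ := hinner l ih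
      rw [h.gamma_update]
      exact div_pos (Real.sqrt_pos.2 (pos_of_isMax_quadraticTransform hX.concaveOn hY ih h1 h2 h3
        hw hX₀)) (S.totalPower_pos _)
  obtain ⟨xs, h1, -, h3, h4⟩ := quadraticTransform_tendsto hXc hX S.continuous_totalPower hY
    S.staticPower_pos S.staticPower_le hw hX₀ hγ (fun l => (hinner l (hγ l)).2.1)
    (fun l => (hinner l (hγ l)).2.2.1) (fun l => (hinner l (hγ l)).2.2.2) (h.gamma_update t)
  have hxs : w (t + 1) = xs := by rw [h.outer_update, h3.limUnder_eq]
  rw [hxs]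
  exact ⟨fun l => (hinner l (hγ l)).1, h3, h1, h4⟩

theorem mem (h : IsAlgorithmRun S k j e w₀ w γ xout x s) (hw₀ : w₀ ∈ S.feasible) (t : ℕ) :
    ‖w t‖ ^ 2 ≤ S.Pmax := by
  induction t with
  | zero => rw [h.init]; exact hw₀
  | succ t ih => exact (h.step ih).2.2.1

/-- The received signal keeps its phase during path following. -/
theorem phase (h : IsAlgorithmRun S k j e w₀ w γ xout x s) (hw₀ : w₀ ∈ S.feasible) {u : ℂ}
    (hu : S.hw k e (w 0) = ‖S.hw k e (w 0)‖ * u) (t : ℕ) :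
    S.hw k e (w t) = ‖S.hw k e (w t)‖ * u := by
  induction t with
  | zero => exact hu
  | succ t ih =>
    obtain ⟨-, -, hmem, hmax⟩ := h.step (h.mem hw₀ t)
    set a := S.hw k e (w t) with ha
    set b := S.hw k e (w (t + 1)) with hb
    have ha0 : 0 < ‖a‖ := norm_pos_iff.2 (Network.hw_ne_zero_of_rate_pos (h.rate_pos t))
    have hb0 : 0 < ‖b‖ := norm_pos_iff.2 (Network.hw_ne_zero_of_rate_pos (h.rate_pos (t + 1)))
    have ha' : (‖a‖ : ℂ) ≠ 0 := by exact_mod_cast ha0.ne'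
    have hb' : (‖b‖ : ℂ) ≠ 0 := by exact_mod_cast hb0.ne'
    -- compare with the rotation of `w (t + 1)` that aligns its signal with that of `w t`
    set c : ℂ := (a / ‖a‖) * (star b / ‖b‖) with hc
    have hcn : ‖c‖ = 1 := by
      rw [hc, norm_mul, norm_div, norm_div, norm_star, Complex.norm_real, Complex.norm_real,
        norm_norm, norm_norm, div_self ha0.ne', div_self hb0.ne', one_mul]
    have hcb : c * b = ‖b‖ * (a / ‖a‖) := by
      have : star b * b = (‖b‖ : ℂ) ^ 2 := by rw [Complex.star_def, Complex.conj_mul']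
      rw [hc, mul_assoc, div_mul_eq_mul_div (star b), this]
      field_simp
    have h1 := hmax (c • w (t + 1)) (by rw [norm_smul, hcn, one_mul]; exact hmem)
    rw [S.totalPower_smul hcn] at h1
    have h2 := le_of_mul_le_mul_right h1 (S.totalPower_pos _)
    -- Only the correlation term sees the rotation, so maximality forces Re(ā b) = |a||b|.
    obtain ⟨A, B, p, q, hB, -, -, hAB⟩ := S.exists_surrogate_eq k j e (w t)
    rw [hAB, hAB, S.leak_smul k j e hcn, S.corrL_apply, S.corrL_apply, S.hw_smul, norm_mul, hcn,
      one_mul, ← ha, ← hb, hcb] at h2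
    have h3 : (star a * (‖b‖ * (a / ‖a‖))).re ≤ (star a * b).re := by
      have : B * (star a * (‖b‖ * (a / ‖a‖))).re ≤ B * (star a * b).re := by linarith
      exact le_of_mul_le_mul_left this hB
    have haa : star a * a = (‖a‖ : ℂ) ^ 2 := by rw [Complex.star_def, Complex.conj_mul']
    have h4 : star a * (‖b‖ * (a / ‖a‖)) = ((‖a‖ * ‖b‖ : ℝ) : ℂ) := by
      rw [show star a * (‖b‖ * (a / ‖a‖)) = ‖b‖ * (star a * a) / ‖a‖ by ring, haa]
      push_cast
      field_simp
    rw [h4, Complex.ofReal_re] at h3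
    have hn : ‖star a * b‖ = ‖a‖ * ‖b‖ := by rw [norm_mul, norm_star]
    have h5 : (star a * b).re = ‖star a * b‖ :=
      le_antisymm (Complex.re_le_norm _) (by rw [hn]; exact h3)
    have h6 : star a * b = ‖a‖ * ‖b‖ := by
      rw [Complex.eq_coe_norm_of_nonneg (Complex.re_eq_norm.1 h5), hn]
      push_cast
      rfl
    have h7 : (‖a‖ : ℂ) ^ 2 * b = ‖a‖ ^ 2 * (‖b‖ * u) := by
      calc (‖a‖ : ℂ) ^ 2 * b = a * (star a * b) := by rw [← haa]; ring
        _ = a * (‖a‖ * ‖b‖) := by rw [h6]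
        _ = (‖a‖ * u) * (‖a‖ * ‖b‖) := by rw [← ih]
        _ = ‖a‖ ^ 2 * (‖b‖ * u) := by ring
    exact mul_left_cancel₀ (pow_ne_zero 2 ha') h7

/-- The ratios satisfy F t ≤ ρ t ≤ F (t+1) ≤ r, so each surrogate ratio is at most the limit r.
Letting only the base point converge along a subsequence bounds the limiting surrogate by r
`totalPower`, with equality at z. -/
theorem exists_isFixed_limit (h : IsAlgorithmRun S k j e w₀ w γ xout x s) (hw₀ : w₀ ∈ S.feasible)
    {u : ℂ} (hu : S.hw k e (w 0) = ‖S.hw k e (w 0)‖ * u) {z : CVec N}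
    (hz : MapClusterPt z atTop w) : S.IsFixed k j e u z := by
  set F : ℕ → ℝ := fun t => S.f k j e (w t) / S.totalPower (w t) with hF
  set ρ : ℕ → ℝ := fun t => S.surrogate k j e (w t) (w (t + 1)) / S.totalPower (w (t + 1)) with hρ
  have hY := S.totalPower_pos
  have hFρ : ∀ t, F t ≤ ρ t := fun t => by
    have := (h.step (h.mem hw₀ t)).2.2.2 (w t) (h.mem hw₀ t)
    rw [S.surrogate_self] at this
    exact (div_le_div_iff₀ (hY _) (hY _)).2 this
  have hρF : ∀ t, ρ t ≤ F (t + 1) := fun t =>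
    div_le_div_of_nonneg_right (S.surrogate_le_f k j e _ _) (hY _).le
  have hmono : Monotone F := monotone_nat_of_le_succ fun t => (hFρ t).trans (hρF t)
  have hFc : Continuous fun v => S.f k j e v / S.totalPower v :=
    (S.continuous_f k j e).div S.continuous_totalPower fun v => (hY v).ne'
  obtain ⟨b, hb⟩ := (isCompact_norm_sq_le (E := CVec N) S.Pmax).exists_bound_of_continuousOn
    hFc.continuousOn
  have hbdd : BddAbove (Set.range F) := ⟨b, by
    rintro _ ⟨t, rfl⟩
    exact (le_abs_self _).trans (hb _ (h.mem hw₀ t))⟩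
  obtain ⟨r, hr⟩ : ∃ r, Tendsto F atTop (𝓝 r) := ⟨_, tendsto_atTop_ciSup hmono hbdd⟩
  have hFle : ∀ t, F t ≤ r := fun t => hmono.ge_of_tendsto hr t
  have hrpos : 0 < r := (div_pos (h.rate_pos 0) (hY _)).trans_le (hFle 0)
  obtain ⟨φ, hφ, hlim⟩ := hz.tendsto_subseq
  have hfz : S.f k j e z = r * S.totalPower z := by
    have h1 : Tendsto (fun n => F (φ n)) atTop (𝓝 (S.f k j e z / S.totalPower z)) :=
      (hFc.tendsto z).comp hlim
    rw [tendsto_nhds_unique (hr.comp hφ.tendsto_atTop) h1, div_mul_cancel₀ _ (hY z).ne']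
  refine ⟨?_, ?_, ?_, fun v hv => ?_⟩
  · have hc : IsClosed {v : CVec N | ‖v‖ ^ 2 ≤ S.Pmax} :=
      isClosed_le (by fun_prop) continuous_const
    exact hc.mem_of_tendsto hlim (Eventually.of_forall fun n => h.mem hw₀ _)
  · rw [hfz]; exact mul_pos hrpos (hY z)
  · have hc : IsClosed {v : CVec N | S.hw k e v = ‖S.hw k e v‖ * u} :=
      isClosed_eq (by fun_prop) (by fun_prop)
    exact hc.mem_of_tendsto hlim (Eventually.of_forall fun n => h.phase hw₀ hu _)
  · have h1 : S.surrogate k j e z v ≤ r * S.totalPower v := by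
      have h2 : Tendsto (fun n => S.surrogate k j e (w (φ n)) v) atTop
          (𝓝 (S.surrogate k j e z v)) :=
        (((S.continuous_surrogate k j e).comp (Continuous.prodMk_left v)).tendsto z).comp hlim
      refine le_of_tendsto' h2 fun n => ?_
      have h3 := (h.step (h.mem hw₀ (φ n))).2.2.2 v hv
      have h4 : S.surrogate k j e (w (φ n)) v ≤ ρ (φ n) * S.totalPower v := by
        simp only [hρ]
        rw [div_mul_eq_mul_div, le_div_iff₀ (hY _)]; exact h3
      refine h4.trans ?_
      have := (hρF (φ n)).trans (hFle _)
      exact mul_le_mul_of_nonneg_right this (hY v).le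
    rw [hfz]
    have := mul_le_mul_of_nonneg_right h1 (hY z).le
    linarith

end IsAlgorithmRun

end SecureRIS

end

theorem theorem3 {K J N M : ℕ} (S : SecureRIS.Network K J N M) (k : Fin K) (j : Fin J)
    (e : Fin M → ℂ) (he : ∀ m, ‖e m‖ = 1)
    (w₀ : SecureRIS.CVec N) (hw₀ : w₀ ∈ S.feasible)
    (w : ℕ → SecureRIS.CVec N) (γ : ℕ → ℕ → ℝ) (xout : ℕ → ℕ → SecureRIS.CVec N)
    (x : ℕ → ℕ → ℕ → SecureRIS.CVec N) (s : ℕ → ℕ → ℕ → ℝ)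
    (hrun : SecureRIS.IsAlgorithmRun S k j e w₀ w γ xout x s) :
    (∀ t l, Filter.Tendsto (x t l) Filter.atTop (nhds (xout t l))) ∧
    (∀ t, Filter.Tendsto (xout t) Filter.atTop (nhds (w (t + 1)))) ∧
    ∃ wstar : SecureRIS.CVec N,
      Filter.Tendsto w Filter.atTop (nhds wstar) ∧
      S.IsKKTPoint k j e wstar ∧
      IsLocalMaxOn (S.objective k j e) S.feasible wstar := by
  have hmem := hrun.mem hw₀
  refine ⟨fun t => (hrun.step (hmem t)).1, fun t => (hrun.step (hmem t)).2.1, ?_⟩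
  have hne : (‖S.hw k e (w 0)‖ : ℂ) ≠ 0 := by
    exact_mod_cast (norm_pos_iff.2
      (SecureRIS.Network.hw_ne_zero_of_rate_pos (hrun.rate_pos 0))).ne'
  have hphase : S.hw k e (w 0) = ‖S.hw k e (w 0)‖ * (S.hw k e (w 0) / ‖S.hw k e (w 0)‖) := by
    rw [mul_div_cancel₀ _ hne]
  have hu : ‖S.hw k e (w 0) / (‖S.hw k e (w 0)‖ : ℂ)‖ = 1 := by
    rw [norm_div, Complex.norm_real, norm_norm, div_self (by exact_mod_cast hne)]
  obtain ⟨v, hv, hmax⟩ := SecureRIS.Network.exists_isFixed_isMaxOn (e := e) hu (hmem 0)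
    (hrun.rate_pos 0)
  refine ⟨v, ?_, hv.isKKTPoint hu, hmax.localize⟩
  -- Every cluster point is a fixed point with the initial phase, hence equals the rotated global
  -- maximizer v.
  exact (SecureRIS.isCompact_norm_sq_le S.Pmax).tendsto_nhds_of_unique_mapClusterPt
    (Eventually.of_forall hmem)
    fun z _ hz => (hrun.exists_isFixed_limit hw₀ hphase hz).unique hu hv
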